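/- Let $\mathfrak g\subset\mathbb R^{n\times n}$ be the Lie algebra of a matrix Lie group, with the restriction of an inner product on $\mathbb R^{n\times n}$, and give $\mathfrak g^2=\mathfrak g\times\mathfrak g$ and $L(\mathfrak g^2,\mathfrak g^2)\cong\mathfrak g^2\otimes\mathfrak g^2$, where $(a\otimes b)x=\langle a,x\rangle b$, the induced inner products, so that $\langle S,T\rangle=\operatorname{tr}(S^*T)$. Let $f:\mathbb R\times\mathfrak g\to\mathfrak g$ be smooth, let $\eta:\mathbb R\to\mathfrak g$ be continuous, and put $$A(t)(\alpha,\beta)=\bigl(-[\eta(t),\alpha]+\beta,\ \tfrac{\partial f}{\partial\eta}(t,\eta(t))\beta\bigr),\qquad B\beta=(0,\beta),\qquad C(\alpha,\beta)=\alpha .$$ Let $v,w$ be $\mathfrak g$-valued Gaussian white noises (generalized processes) of mean zero with $\operatorname{cov}[v(t);v(s)]=\delta(t-s)R(t)$ and $\operatorname{cov}[w(t);w(s)]=\delta(t-s)Q(t)$, that is, $E\bigl[\int\langle\varphi,v\rangle dt\int\langle\psi,v\rangle dt\bigr]=\int\langle\varphi(t),R(t)\psi(t)\rangle\,dt$ for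 bounded measurable $\varphi,\psi:\mathbb R\to\mathfrak g$ of compact support, and likewise for $w$ and $Q$. Here $R(t)\in L(\mathfrak g,\mathfrak g)$ is symmetric positive definite, $Q(t)\in L(\mathfrak g,\mathfrak g)$ is symmetric positive semidefinite, and both are measurable and locally bounded in $t$. Let $\Delta_0$ be a random variable in $\mathfrak g^2$ such that $v$, $w$, $\Delta_0$ are mutually independent. Fix $t_0<\tau$ and a symmetric positive definite $M\in L(\mathfrak g^2,\mathfrak g^2)$. A gain is a measurable, locally bounded map $K:\mathbb R\to L(\mathfrak g,\mathfrak g^2)$. An error process for $K$ is a measurable process $\Delta$ with integrable paths on $[t_0,\tau]$ that satisfies (in integrated form, almost surely for each $t$) $$\dot\Delta(t)=(A(t)-K(t)C)\Delta(t)-Bw(t)+K(t)v(t)\quad(t_0\le t\le\tau),\qquad \Delta(t_0)=\Delta_0 .\tag{1}$$ (i) Suppose $E|\Delta_0|^2<\infty$. For every gain $K$ and every error process $\Delta$ for $K$, $E|\Delta(t)|^2<\infty$ on $[t_0,\tau]$, and $\Sigma(t)=E[\Delta(t)\otimes\Delta(t)]$ satisfies on $[t_0,\tau]$ $$\dot\Sigma=(A-KC)\Sigma+\Sigma(A-KC)^*+BQB^*+KRK^*,\tag{2}$$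 in the sense that $\Sigma$ is continuous and solves the integrated equation, and (2) holds at almost every $t$ and at every $t$ at which $K,Q,R$ are continuous (everywhere if they are continuous; one-sided derivatives at the ends). Moreover $E\langle\Delta(\tau),M\Delta(\tau)\rangle=\langle M,\Sigma(\tau)\rangle$. (ii) Suppose $\Delta_0\sim\mathcal N(0,\Sigma_0)$ with $\Sigma_0$ symmetric positive definite. For every class $\mathcal K$ of gains, the stochastic problem of minimizing $E\langle\Delta(\tau),M\Delta(\tau)\rangle$ over $K\in\mathcal K$ subject to (1) is equivalent to the deterministic problem of minimizing $\langle M,\Sigma(\tau)\rangle$ over $K\in\mathcal K$ subject to (2) and $\Sigma(t_0)=\Sigma_0$: for every $K\in\mathcal K$ both (1) and (2) have solutions, for any such solutions $\Delta$ and $\Sigma$ one has $\Sigma(t)=E[\Delta(t)\otimes\Delta(t)]$ on $[t_0,\tau]$ and the two costs are equal, the two problems have the same set of attainable values, and the same gains are optimal in both. -/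

import Mathlib

open MeasureTheory ProbabilityTheory Set
open scoped InnerProductSpace

attribute [local instance 100] LieRing.ofAssociativeRing

noncomputable section

/-! ### The Lie algebra of a matrix Lie group, with an inner product restricted from `ℝ^{n×n}` -/

section LieAlgebra

variable {n : ℕ} (𝔤 : LieSubalgebra ℝ (Matrix (Fin n) (Fin n) ℝ))
  (ip : InnerProductSpace.Core ℝ (Matrix (Fin n) (Fin n) ℝ))

/-- The matrix Lie algebra `𝔤`, to be equipped with the restriction of the inner product `ip` on
`ℝ^{n×n}`. (A type synonym, because no norm on matrices is canonical.) -/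
def MatLie (_ip : InnerProductSpace.Core ℝ (Matrix (Fin n) (Fin n) ℝ)) : Type := 𝔤

namespace MatLie

/-- The algebraic structure inherited from `𝔤`. -/
@[reducible] def addCommGroup : AddCommGroup (MatLie 𝔤 ip) := inferInstanceAs (AddCommGroup 𝔤)

attribute [local instance] addCommGroup

/-- The linear structure inherited from `𝔤`. -/
@[reducible] def module : Module ℝ (MatLie 𝔤 ip) := inferInstanceAs (Module ℝ 𝔤)

attribute [local instance] module

/-- The restriction of the inner product `ip` to `𝔤`. -/
@[reducible] def core : InnerProductSpace.Core ℝ (MatLie 𝔤 ip) where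
  inner x y := ip.inner (Subtype.val x) (Subtype.val y)
  conj_inner_symm _ _ := ip.conj_inner_symm _ _
  re_inner_nonneg _ := ip.re_inner_nonneg _
  add_left _ _ _ := ip.add_left _ _ _
  smul_left _ _ _ := ip.smul_left _ _ _
  definite _ h := Subtype.ext (ip.definite _ h)

instance normedAddCommGroup : NormedAddCommGroup (MatLie 𝔤 ip) :=
  (core 𝔤 ip).toNormedAddCommGroup

instance innerProductSpace : InnerProductSpace ℝ (MatLie 𝔤 ip) :=
  InnerProductSpace.ofCore (core 𝔤 ip).toCore

instance finiteDimensional : FiniteDimensional ℝ (MatLie 𝔤 ip) :=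
  inferInstanceAs (FiniteDimensional ℝ 𝔤)

instance measurableSpace : MeasurableSpace (MatLie 𝔤 ip) := borel _

instance borelSpace : BorelSpace (MatLie 𝔤 ip) := ⟨rfl⟩

variable {𝔤 ip}

/-- The operator `ad_η : α ↦ [η, α] = η α - α η` on `𝔤`. -/
def ad (η : MatLie 𝔤 ip) : MatLie 𝔤 ip →L[ℝ] MatLie 𝔤 ip :=
  LinearMap.toContinuousLinearMap
    (show MatLie 𝔤 ip →ₗ[ℝ] MatLie 𝔤 ip from LieAlgebra.ad ℝ 𝔤 (show 𝔤 from η))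

end MatLie

end LieAlgebra

/-! ### Operators on `E²` -/

section Operators

/-- `E² = E × E` with the product inner product. -/
abbrev Sq (E : Type*) : Type _ := WithLp 2 (E × E)

variable {E : Type*} [NormedAddCommGroup E] [InnerProductSpace ℝ E]

/-- `B β = (0, β)`. -/
def opB : E →L[ℝ] Sq E :=
  (WithLp.prodContinuousLinearEquiv 2 ℝ E E).symm.toContinuousLinearMap ∘L
    ContinuousLinearMap.inr ℝ E E

/-- `C (α, β) = α`. -/
def opC : Sq E →L[ℝ] E := WithLp.fstL 2 ℝ E E

/-- The block operator `(α, β) ↦ (-D α + β, F β)`. -/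
def opA (D F : E →L[ℝ] E) : Sq E →L[ℝ] Sq E :=
  (WithLp.prodContinuousLinearEquiv 2 ℝ E E).symm.toContinuousLinearMap ∘L
    ContinuousLinearMap.prod
      (-(D ∘L WithLp.fstL 2 ℝ E E) + WithLp.sndL 2 ℝ E E)
      (F ∘L WithLp.sndL 2 ℝ E E)

/-- A symmetric positive definite operator. -/
def IsPosDefOp {X : Type*} [NormedAddCommGroup X] [InnerProductSpace ℝ X]
    (S : X →L[ℝ] X) : Prop :=
  (S : X →ₗ[ℝ] X).IsSymmetric ∧ ∀ x, x ≠ 0 → 0 < ⟪x, S x⟫_ℝ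

/-- A symmetric positive semidefinite operator. -/
def IsPosSemidefOp {X : Type*} [NormedAddCommGroup X] [InnerProductSpace ℝ X]
    (S : X →L[ℝ] X) : Prop :=
  (S : X →ₗ[ℝ] X).IsSymmetric ∧ ∀ x, 0 ≤ ⟪x, S x⟫_ℝ

/-- The inner product of `L(X, X) = X ⊗ X` induced from `X`, that is
`⟨a ⊗ b, c ⊗ d⟩ = ⟨a, c⟩⟨b, d⟩`, written as `⟨S, T⟩ = tr (S* T)`. -/
def opInner {X : Type*} [NormedAddCommGroup X] [InnerProductSpace ℝ X] [CompleteSpace X]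
    (S T : X →L[ℝ] X) : ℝ :=
  LinearMap.trace ℝ X (ContinuousLinearMap.adjoint S ∘L T : X →L[ℝ] X)

/-- A measurable function of time that is bounded on every bounded interval. -/
def MeasLocBdd {V : Type*} [NormedAddCommGroup V] [MeasurableSpace V] (φ : ℝ → V) : Prop :=
  Measurable φ ∧ ∀ a b : ℝ, ∃ c : ℝ, ∀ t ∈ Icc a b, ‖φ t‖ ≤ c

end Operators

/-! ### White noise -/

section Noise

variable {E : Type*} [NormedAddCommGroup E] [InnerProductSpace ℝ E] [MeasurableSpace E]
  {Ω : Type*} [MeasurableSpace Ω]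

/-- Test functions for white noise: measurable, bounded, with compact support. -/
def IsTestFun (φ : ℝ → E) : Prop :=
  Measurable φ ∧ (∃ c : ℝ, ∀ t, ‖φ t‖ ≤ c) ∧ HasCompactSupport φ

/-- A generalized `E`-valued process, given by the random variables
`v φ = ∫ ⟨φ t, v(t)⟩ dt` (values at functions `φ` that are no test functions are irrelevant), is
Gaussian white noise of mean zero and covariance `cov[v(t); v(s)] = δ(t - s) S(t)`, that is
`E[v φ * v ψ] = ∫ ⟨φ t, S(t) ψ(t)⟩ dt`. -/
structure IsWhiteNoise (P : Measure Ω) (S : ℝ → E →L[ℝ] E) (v : (ℝ → E) → Ω → ℝ) : Prop where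
  measurable : ∀ φ, IsTestFun φ → Measurable (v φ)
  gaussian : IsGaussianProcess (fun φ : {φ : ℝ → E // IsTestFun φ} => v φ) P
  mean_zero : ∀ φ, IsTestFun φ → ∫ ω, v φ ω ∂P = 0
  covariance : ∀ φ ψ, IsTestFun φ → IsTestFun ψ →
    ∫ ω, v φ ω * v ψ ω ∂P = ∫ t, ⟪φ t, S t (ψ t)⟫_ℝ

/-- The σ-algebra generated by a generalized process. -/
@[reducible] def noiseSigma (v : (ℝ → E) → Ω → ℝ) : MeasurableSpace Ω :=
  MeasurableSpace.comap (fun ω (φ : {φ : ℝ → E // IsTestFun φ}) => v φ ω) inferInstance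

/-- The standing assumption on the noise: `v`, `w` are white, Gaussian, of mean zero, with
covariance operators `R(t)` (symmetric positive definite) and `Q(t)` (symmetric positive
semidefinite), and `v`, `w` and the initial state `Δ₀` are mutually independent. -/
structure NoiseAssumption {X : Type*} [MeasurableSpace X] (P : Measure Ω)
    (Q R : ℝ → E →L[ℝ] E) (v w : (ℝ → E) → Ω → ℝ) (Δ₀ : Ω → X) : Prop where
  posDef_R : ∀ t, IsPosDefOp (R t)
  posSemidef_Q : ∀ t, IsPosSemidefOp (Q t)
  white_v : IsWhiteNoise P R v
  white_w : IsWhiteNoise P Q w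
  measurable_init : Measurable Δ₀
  indep : iIndep ![noiseSigma v, noiseSigma w, MeasurableSpace.comap Δ₀ inferInstance] P

end Noise

/-! ### The error process and its covariance -/

section ErrorProcess

variable {E : Type*} [NormedAddCommGroup E] [InnerProductSpace ℝ E] [CompleteSpace E]
  [MeasurableSpace E] [BorelSpace E] {Ω : Type*} [MeasurableSpace Ω]

/-- `Δ` solves `Δ̇(t) = (A(t) - K(t) C) Δ(t) - B w(t) + K(t) v(t)` on `[t₀, τ]` with initial state
`Δ₀`: it is a measurable process with locally integrable paths, and the equation holds after
integration over `[t₀, t]` (and pairing with any vector `ζ`), for every `t`. The integral of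
`⟨ζ, K(s) v(s)⟩ = ⟨K(s)* ζ, v(s)⟩` over `[t₀, t]` is `v` applied to the test function
`1_{(t₀, t]} K* ζ`, and similarly for `w`. -/
structure IsErrorProcess (P : Measure Ω) (t₀ τ : ℝ) (A : ℝ → Sq E →L[ℝ] Sq E)
    (K : ℝ → E →L[ℝ] Sq E) (v w : (ℝ → E) → Ω → ℝ) (Δ₀ : Ω → Sq E) (Δ : ℝ → Ω → Sq E) :
    Prop where
  measurable : Measurable (fun p : ℝ × Ω => Δ p.1 p.2)
  integrable : ∀ᵐ ω ∂P, IntegrableOn (fun s => Δ s ω) (Icc t₀ τ)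
  initial : Δ t₀ =ᵐ[P] Δ₀
  dynamics : ∀ t ∈ Icc t₀ τ, ∀ ζ : Sq E, ∀ᵐ ω ∂P,
    ⟪ζ, Δ t ω⟫_ℝ = ⟪ζ, Δ₀ ω⟫_ℝ
      + (∫ s in t₀..t, ⟪ζ, (A s - K s ∘L opC) (Δ s ω)⟫_ℝ)
      - w ((Ioc t₀ t).indicator fun _ => ContinuousLinearMap.adjoint opB ζ) ω
      + v ((Ioc t₀ t).indicator fun s => ContinuousLinearMap.adjoint (K s) ζ) ω

/-- `E[Z ⊗ Z]` as an operator, with `(a ⊗ b) x = ⟨a, x⟩ b`. -/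
def secondMoment {X : Type*} [NormedAddCommGroup X] [InnerProductSpace ℝ X]
    (P : Measure Ω) (Z : Ω → X) : X →L[ℝ] X :=
  ∫ ω, InnerProductSpace.rankOne ℝ (Z ω) (Z ω) ∂P

/-- `Z ∼ 𝒩(0, S)`. -/
structure IsCenteredGaussian {X : Type*} [NormedAddCommGroup X] [InnerProductSpace ℝ X]
    [MeasurableSpace X] (P : Measure Ω) (Z : Ω → X) (S : X →L[ℝ] X) : Prop where
  gaussian : HasGaussianLaw Z P
  mean_zero : ∫ ω, Z ω ∂P = 0
  covariance : secondMoment P Z = S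

/-- The right-hand side
`(A(t) - K(t) C) S + S (A(t) - K(t) C)* + B Q(t) B* + K(t) R(t) K(t)*`. -/
def covField (A : ℝ → Sq E →L[ℝ] Sq E) (Q R : ℝ → E →L[ℝ] E) (K : ℝ → E →L[ℝ] Sq E)
    (t : ℝ) (S : Sq E →L[ℝ] Sq E) : Sq E →L[ℝ] Sq E :=
  (A t - K t ∘L opC) ∘L S + S ∘L ContinuousLinearMap.adjoint (A t - K t ∘L opC)
    + opB ∘L Q t ∘L ContinuousLinearMap.adjoint opB
    + K t ∘L R t ∘L ContinuousLinearMap.adjoint (K t)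

/-- `Σ̇ = covField(t, Σ)` on `[t₀, τ]`, with `Σ(t₀) = S₀`. As the coefficients are only assumed
measurable and bounded, this is meant in the sense of Carathéodory (the integrated equation with
continuous `Σ`), together with the differential equation itself at almost every time and at every
time where the coefficients `K`, `Q`, `R` are continuous (one-sided derivatives at the ends). -/
structure SolvesCovDyn (t₀ τ : ℝ) (A : ℝ → Sq E →L[ℝ] Sq E) (Q R : ℝ → E →L[ℝ] E)
    (K : ℝ → E →L[ℝ] Sq E) (S₀ : Sq E →L[ℝ] Sq E) (S : ℝ → Sq E →L[ℝ] Sq E) : Prop where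
  continuousOn : ContinuousOn S (Icc t₀ τ)
  initial : S t₀ = S₀
  integral_eq : ∀ t ∈ Icc t₀ τ, S t = S₀ + ∫ s in t₀..t, covField A Q R K s (S s)
  ae_deriv : ∀ᵐ t ∂(volume.restrict (Icc t₀ τ)), HasDerivAt S (covField A Q R K t (S t)) t
  deriv : ∀ t ∈ Icc t₀ τ, ContinuousWithinAt K (Icc t₀ τ) t →
    ContinuousWithinAt Q (Icc t₀ τ) t → ContinuousWithinAt R (Icc t₀ τ) t →
    HasDerivWithinAt S (covField A Q R K t (S t)) (Icc t₀ τ) t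

/-- The feasible set of the stochastic problem: an admissible gain with an error process for it. -/
def stochFeasible (P : Measure Ω) (t₀ τ : ℝ) (A : ℝ → Sq E →L[ℝ] Sq E)
    (v w : (ℝ → E) → Ω → ℝ) (Δ₀ : Ω → Sq E) (𝒦 : Set (ℝ → E →L[ℝ] Sq E)) :
    Set ((ℝ → E →L[ℝ] Sq E) × (ℝ → Ω → Sq E)) :=
  {p | p.1 ∈ 𝒦 ∧ IsErrorProcess P t₀ τ A p.1 v w Δ₀ p.2}

/-- The cost `E⟨Δ(τ), M Δ(τ)⟩` of the stochastic problem. -/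
def stochCost (P : Measure Ω) (τ : ℝ) (M : Sq E →L[ℝ] Sq E) (Δ : ℝ → Ω → Sq E) : ℝ :=
  ∫ ω, ⟪Δ τ ω, M (Δ τ ω)⟫_ℝ ∂P

/-- The feasible set of the deterministic problem: an admissible gain with a solution of the
covariance equation for it. -/
def detFeasible (t₀ τ : ℝ) (A : ℝ → Sq E →L[ℝ] Sq E) (Q R : ℝ → E →L[ℝ] E)
    (S₀ : Sq E →L[ℝ] Sq E) (𝒦 : Set (ℝ → E →L[ℝ] Sq E)) :
    Set ((ℝ → E →L[ℝ] Sq E) × (ℝ → Sq E →L[ℝ] Sq E)) :=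
  {p | p.1 ∈ 𝒦 ∧ SolvesCovDyn t₀ τ A Q R p.1 S₀ p.2}

/-- The cost `⟨M, Σ(τ)⟩` of the deterministic problem. -/
def detCost (τ : ℝ) (M : Sq E →L[ℝ] Sq E) (S : ℝ → Sq E →L[ℝ] Sq E) : ℝ :=
  opInner M (S τ)

end ErrorProcess

instance MatLie.completeSpace {n : ℕ} (𝔤 : LieSubalgebra ℝ (Matrix (Fin n) (Fin n) ℝ))
    (ip : InnerProductSpace.Core ℝ (Matrix (Fin n) (Fin n) ℝ)) : CompleteSpace (MatLie 𝔤 ip) :=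
  FiniteDimensional.complete ℝ _

/-- The operator `A(t) (α, β) = (-ad_{η(t)} α + β, ∂f/∂η (t, η(t)) β)` of the error dynamics
linearized along the estimate `η`. -/
def errorGenerator {n : ℕ} {𝔤 : LieSubalgebra ℝ (Matrix (Fin n) (Fin n) ℝ)}
    {ip : InnerProductSpace.Core ℝ (Matrix (Fin n) (Fin n) ℝ)}
    (f : ℝ → MatLie 𝔤 ip → MatLie 𝔤 ip) (η : ℝ → MatLie 𝔤 ip) (t : ℝ) :
    Sq (MatLie 𝔤 ip) →L[ℝ] Sq (MatLie 𝔤 ip) :=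
  opA (MatLie.ad (η t)) (fderiv ℝ (f t) (η t))

end

/-! The integrated error equation has the form `Δ t = X₀ + ∫ L Δ + N t` with `L = A - K C`, where
`N` is the integral of `K v - B w`. Only second moments matter. Whiteness and independence say
exactly that `E[N s ⟨N t, ·⟩] = G s` for `s ≤ t`, with `G t = ∫ (B Q B* + K R K*)` over `[t₀, t]`,
and that `N` is uncorrelated with `X₀` (`NoiseAssumption.isAdditiveNoise`). Stochastic calculus is
not needed.

Every path of `X = Δ - N` is absolutely continuous, so the ordinary product rule gives an integral
equation for `E[X ⊗ X]` (`cross_sub_self`). It contains the correlation of `Δ s` with `N s`. By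
Grönwall this equals the correlation `V s` of `Δ s` with the terminal value `N τ`
(`cross_noise_eq`), and `V = ∫ L V + G`. When `E[X ⊗ X]` is expanded in terms of `Δ` and `N`, the
terms in `V` cancel and one copy of `G` survives: this is the Lyapunov equation (`cross_self_eq`).
The required square integrability comes from a pathwise Grönwall bound (`exists_dominating`).

For the equivalence of the control problems, an error process exists for each gain: the driving
noise has a jointly measurable version (`exists_measurable_modification`), and a Neumann series then
solves the equation path by path (`exists_measurable_solution`). Its second moment solves the
covariance equation, and Grönwall makes that solution unique (`SolvesLyapunov.eqOn`). Both problems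
thus attach one and the same cost to each gain, because `⟨x, M x⟩ = ⟨M, x ⊗ x⟩` passes to
expectations. -/

set_option linter.unusedSectionVars false

/-! ### Integral inequalities and products of absolutely continuous functions -/

/-- **Grönwall's inequality** in integral form, for an integrable function. -/
theorem le_mul_exp_of_le_add_mul_integral {u : ℝ → ℝ} {a c t₀ τ : ℝ} (hc : 0 ≤ c)
    (hu : IntegrableOn u (Icc t₀ τ))
    (h : ∀ t ∈ Icc t₀ τ, u t ≤ a + c * ∫ s in t₀..t, u s) :
    ∀ t ∈ Icc t₀ τ, u t ≤ a * Real.exp (c * (t - t₀)) := by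
  intro t ht
  have hle : t₀ ≤ τ := ht.1.trans ht.2
  -- `u` is merely integrable, so its bound `w` is continuous but need not be differentiable. One
  -- more iteration, `w ≤ a + c ∫ w`, has a continuously differentiable right-hand side, to which
  -- the differential form of Grönwall applies.
  set w : ℝ → ℝ := fun t => a + c * ∫ s in t₀..t, u s with hw
  have hwc : ContinuousOn w (Icc t₀ τ) :=
    continuousOn_const.add (continuousOn_const.mul
      (intervalIntegral.continuousOn_primitive_interval (by rwa [uIcc_of_le hle]) |>.mono
        (by rw [uIcc_of_le hle])))
  have hwi : IntegrableOn w (Icc t₀ τ) := hwc.integrableOn_Icc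
  have hwd : ∀ x ∈ Icc t₀ τ,
      HasDerivWithinAt (fun t => a + c * ∫ s in t₀..t, w s) (c * w x) (Icc t₀ τ) x := by
    intro x hx
    have := Fact.mk hx
    refine HasDerivWithinAt.const_add _ (HasDerivWithinAt.const_mul _ ?_)
    refine intervalIntegral.integral_hasDerivWithinAt_right ?_
      (hwc.stronglyMeasurableAtFilter_nhdsWithin measurableSet_Icc x) (hwc x hx)
    exact (intervalIntegrable_iff_integrableOn_Icc_of_le hx.1).2
      (hwi.mono_set (Icc_subset_Icc_right hx.2))
  have hww : ∀ x ∈ Icc t₀ τ, w x ≤ a + c * ∫ s in t₀..x, w s := by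
    intro x hx
    refine add_le_add le_rfl (mul_le_mul_of_nonneg_left ?_ hc)
    refine intervalIntegral.integral_mono_on hx.1 ?_ ?_ fun s hs => h s ⟨hs.1, hs.2.trans hx.2⟩
    · exact (intervalIntegrable_iff_integrableOn_Icc_of_le hx.1).2
        (hu.mono_set (Icc_subset_Icc_right hx.2))
    · exact (intervalIntegrable_iff_integrableOn_Icc_of_le hx.1).2
        (hwi.mono_set (Icc_subset_Icc_right hx.2))
  refine (h t ht).trans ((hww t ht).trans ?_)
  rw [← gronwallBound_ε0]
  refine le_gronwallBound_of_liminf_deriv_right_le (f := fun t => a + c * ∫ s in t₀..t, w s)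
    (f' := fun x => c * w x)
    (fun x hx => (hwd x hx).continuousWithinAt) ?_ (by simp) ?_ t ht
  · intro x hx r hr
    have := ((hwd x ⟨hx.1, hx.2.le⟩).mono_of_mem_nhdsWithin
      (Icc_mem_nhdsGE_of_mem hx)).liminf_right_slope_le hr
    simpa [slope_def_field, div_eq_inv_mul] using this
  · intro x hx
    rw [add_zero]
    exact mul_le_mul_of_nonneg_left (hww x ⟨hx.1, hx.2.le⟩) hc

/-- A solution of a linear integral inequality with zero data vanishes. -/
theorem eq_zero_of_norm_le_mul_integral {V : Type*} [NormedAddCommGroup V] {u : ℝ → V}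
    {c t₀ τ : ℝ} (hc : 0 ≤ c) (hu : IntegrableOn u (Icc t₀ τ))
    (h : ∀ t ∈ Icc t₀ τ, ‖u t‖ ≤ c * ∫ s in t₀..t, ‖u s‖) : ∀ t ∈ Icc t₀ τ, u t = 0 := by
  intro t ht
  have := le_mul_exp_of_le_add_mul_integral (a := 0) hc hu.norm (by simpa using h) t ht
  simpa using this

/-- Integration by parts for absolutely continuous functions: since `g` and `h` are only integrable,
the derivatives of the two primitives are known almost everywhere, which is enough under the
integral. -/
theorem add_integral_mul_add_integral {u₀ v₀ t₀ t : ℝ} {g h : ℝ → ℝ}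
    (hg : IntervalIntegrable g volume t₀ t) (hh : IntervalIntegrable h volume t₀ t) :
    (u₀ + ∫ s in t₀..t, g s) * (v₀ + ∫ s in t₀..t, h s) = u₀ * v₀ +
      ∫ s in t₀..t, (g s * (v₀ + ∫ r in t₀..s, h r) + (u₀ + ∫ r in t₀..s, g r) * h s) := by
  have hconst : ∀ c : ℝ, AbsolutelyContinuousOnInterval (fun _ : ℝ => c) t₀ t := fun c =>
    (LipschitzWith.const (α := ℝ) c).lipschitzOnWith.absolutelyContinuousOnInterval
  have hG := (hconst u₀).fun_add
    (hg.absolutelyContinuousOnInterval_intervalIntegral (c := t₀) (by simp))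
  have hH := (hconst v₀).fun_add
    (hh.absolutelyContinuousOnInterval_intervalIntegral (c := t₀) (by simp))
  have key := hG.integral_deriv_mul_eq_sub hH
  simp only [intervalIntegral.integral_same, add_zero] at key
  rw [← sub_eq_iff_eq_add', ← key]
  refine intervalIntegral.integral_congr_ae ?_
  filter_upwards [hg.ae_hasDerivAt_integral, hh.ae_hasDerivAt_integral] with x hx₁ hx₂ hx
  have hx' := uIoc_subset_uIcc hx
  rw [((hx₁ hx' t₀ (by simp)).const_add u₀).deriv, ((hx₂ hx' t₀ (by simp)).const_add v₀).deriv]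

/-! ### Rank-one operators and their product rule -/

section Outer

variable {H : Type*} [NormedAddCommGroup H] [InnerProductSpace ℝ H]

/-- The bilinear map `(x, y) ↦ ⟨y, ·⟩ x`. -/
noncomputable def outer : H →L[ℝ] H →L[ℝ] H →L[ℝ] H :=
  LinearMap.mkContinuous₂
    (LinearMap.mk₂ ℝ (fun x y : H => InnerProductSpace.rankOne ℝ x y)
      (by simp) (by simp) (by simp) (by simp)) 1 (by simp)

theorem outer_eq_rankOne (x y : H) : outer x y = InnerProductSpace.rankOne ℝ x y := rfl

@[simp] theorem outer_apply (x y z : H) : outer x y z = ⟪y, z⟫_ℝ • x := rfl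

attribute [irreducible] outer

@[simp] theorem norm_outer (x y : H) : ‖outer x y‖ = ‖x‖ * ‖y‖ := by
  rw [outer_eq_rankOne, InnerProductSpace.norm_rankOne]

theorem inner_outer (x y a b : H) : ⟪a, outer x y b⟫_ℝ = ⟪a, x⟫_ℝ * ⟪y, b⟫_ℝ := by
  simp [inner_smul_right, mul_comm]

theorem comp_outer (T : H →L[ℝ] H) (x y : H) : T ∘L outer x y = outer (T x) y := by
  ext; simp

theorem continuous_outer : Continuous fun p : H × H => outer p.1 p.2 :=
  (outer (H := H)).isBoundedBilinearMap.continuous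

theorem aestronglyMeasurable_outer {α : Type*} [MeasurableSpace α] {μ : Measure α} {x y : α → H}
    (hx : AEStronglyMeasurable x μ) (hy : AEStronglyMeasurable y μ) :
    AEStronglyMeasurable (fun a => outer (x a) (y a)) μ :=
  (continuous_outer (H := H)).comp_aestronglyMeasurable (hx.prodMk hy)

/-- An operator is determined by its matrix coefficients. -/
theorem clm_ext_inner {S T : H →L[ℝ] H} (h : ∀ a b, ⟪a, S b⟫_ℝ = ⟪a, T b⟫_ℝ) : S = T :=
  ContinuousLinearMap.ext fun b => ext_inner_left ℝ fun a => h a b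

/-- The functional `T ↦ ⟨a, T b⟩`. -/
noncomputable def matrixCoeff (a b : H) : (H →L[ℝ] H) →L[ℝ] ℝ :=
  innerSL ℝ a ∘L ContinuousLinearMap.apply ℝ H b

@[simp] theorem matrixCoeff_apply (a b : H) (T : H →L[ℝ] H) :
    matrixCoeff a b T = ⟪a, T b⟫_ℝ := rfl

variable [CompleteSpace H]

/-- Matrix coefficients turn this into the scalar product rule for the functions `⟪a, x₀ + ∫ g⟫` and
`⟪b, x₀ + ∫ g⟫`. -/
theorem outer_add_integral {x₀ : H} {t₀ t : ℝ} {g : ℝ → H}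
    (hg : IntervalIntegrable g volume t₀ t) :
    outer (x₀ + ∫ s in t₀..t, g s) (x₀ + ∫ s in t₀..t, g s) = outer x₀ x₀ +
      ∫ s in t₀..t, (outer (g s) (x₀ + ∫ r in t₀..s, g r)
        + outer (x₀ + ∫ r in t₀..s, g r) (g s)) := by
  have hX : ContinuousOn (fun t => x₀ + ∫ s in t₀..t, g s) (uIcc t₀ t) :=
    continuousOn_const.add (intervalIntegral.continuousOn_primitive_interval' hg (by simp))
  obtain ⟨C, hC⟩ := isCompact_uIcc.exists_bound_of_continuousOn hX
  have hXm := (hX.aestronglyMeasurable (μ := volume) measurableSet_uIcc).mono_set uIoc_subset_uIcc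
  have hgm := (intervalIntegrable_iff.1 hg).aestronglyMeasurable
  have h₁ : IntervalIntegrable (fun s => outer (g s) (x₀ + ∫ r in t₀..s, g r)
      + outer (x₀ + ∫ r in t₀..s, g r) (g s)) volume t₀ t := by
    rw [intervalIntegrable_iff]
    refine ((intervalIntegrable_iff.1 hg).norm.const_mul (2 * C)).mono' ?_ ?_
    · exact (aestronglyMeasurable_outer hgm hXm).add (aestronglyMeasurable_outer hXm hgm)
    · filter_upwards [ae_restrict_mem measurableSet_uIoc] with s hs
      refine (norm_add_le _ _).trans ?_
      rw [norm_outer, norm_outer]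
      nlinarith [hC s (uIoc_subset_uIcc hs), norm_nonneg (g s)]
  have hgi : ∀ a : H, ∀ s ∈ uIcc t₀ t,
      ⟪a, ∫ r in t₀..s, g r⟫_ℝ = ∫ r in t₀..s, ⟪a, g r⟫_ℝ := fun a s hs =>
    ((innerSL ℝ a).intervalIntegral_comp_comm (hg.mono_set
      (uIcc_subset_uIcc_left hs))).symm
  refine clm_ext_inner fun a b => ?_
  rw [add_apply, inner_add_right, inner_outer, inner_outer,
    ← matrixCoeff_apply a b (∫ s in t₀..t, _),
    ← ContinuousLinearMap.intervalIntegral_comp_comm _ h₁]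
  simp only [map_add (matrixCoeff a b), matrixCoeff_apply, inner_outer]
  have hi : ∀ a : H, IntervalIntegrable (fun s => ⟪a, g s⟫_ℝ) volume t₀ t := fun a =>
    ⟨(innerSL ℝ a).integrable_comp hg.1, (innerSL ℝ a).integrable_comp hg.2⟩
  have e : ∀ a : H, ∀ s ∈ uIcc t₀ t,
      ⟪a, x₀ + ∫ r in t₀..s, g r⟫_ℝ = ⟪a, x₀⟫_ℝ + ∫ r in t₀..s, ⟪a, g r⟫_ℝ := fun a s hs => by
    rw [inner_add_right, hgi a s hs]
  -- Symmetry brings the second factor to the form that `e` rewrites.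
  have hb : ∀ y, ⟪y, b⟫_ℝ = innerSL ℝ b y := fun y => by
    rw [innerSL_apply_apply, real_inner_comm]
  simp only [hb]
  simp only [innerSL_apply_apply]
  rw [e a t (by simp), e b t (by simp), add_integral_mul_add_integral (hi a) (hi b)]
  congr 1
  refine intervalIntegral.integral_congr fun s hs => ?_
  simp only [e a s hs, e b s hs]

end Outer

/-! ### Measurable solutions of linear integral equations -/

section Picard

variable {H : Type*} [NormedAddCommGroup H] [InnerProductSpace ℝ H] [FiniteDimensional ℝ H]
  [MeasurableSpace H] [BorelSpace H] {Ω : Type*} [MeasurableSpace Ω]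

theorem measurable_clm_apply {α : Type*} [MeasurableSpace α] {L : α → H →L[ℝ] H} {x : α → H}
    (hL : Measurable L) (hx : Measurable x) : Measurable fun a => L a (x a) :=
  isBoundedBilinearMap_apply.continuous.measurable.comp (hL.prodMk hx)

/-- The oriented integral is the difference of the integrals over `Ioc t₀ t` and `Ioc t t₀`. Each of
them is the integral of a jointly measurable indicator function over a fixed domain, the moving
endpoint having become part of the indicator. -/
theorem measurable_primitive {F : ℝ → Ω → H} (hF : Measurable fun p : ℝ × Ω => F p.1 p.2)
    (t₀ : ℝ) : Measurable fun p : ℝ × Ω => ∫ s in t₀..p.1, F s p.2 := by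
  have key : ∀ S : ℝ × Ω → Set ℝ, (∀ p, MeasurableSet (S p)) →
      MeasurableSet {q : (ℝ × Ω) × ℝ | q.2 ∈ S q.1} →
      Measurable fun p : ℝ × Ω => ∫ s in S p, F s p.2 := by
    intro S hS hS'
    have : StronglyMeasurable fun q : (ℝ × Ω) × ℝ =>
        {q : (ℝ × Ω) × ℝ | q.2 ∈ S q.1}.indicator (fun q => F q.2 q.1.2) q :=
      (Measurable.indicator (hF.comp (measurable_snd.prodMk (measurable_snd.comp measurable_fst)))
        hS').stronglyMeasurable
    convert! (this.integral_prod_right' (ν := volume)).measurable using 2 with p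
    rw [← integral_indicator (hS p)]
    rfl
  refine Measurable.sub (key (fun p => Ioc t₀ p.1) (fun _ => measurableSet_Ioc) ?_)
    (key (fun p => Ioc p.1 t₀) (fun _ => measurableSet_Ioc) ?_)
  · exact (measurableSet_lt measurable_const measurable_snd).inter
      (measurableSet_le measurable_snd (measurable_fst.comp measurable_fst))
  · exact (measurableSet_lt (measurable_fst.comp measurable_fst) measurable_snd).inter
      (measurableSet_le measurable_snd measurable_const)

theorem measurable_clm_apply_uncurry {L : ℝ → H →L[ℝ] H} (hL : Measurable L) {F : ℝ → Ω → H}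
    (hF : Measurable fun p : ℝ × Ω => F p.1 p.2) :
    Measurable fun p : ℝ × Ω => L p.1 (F p.1 p.2) :=
  measurable_clm_apply (hL.comp measurable_fst) hF

/-- The successive terms of the Neumann series of `x = F + ∫ L x` on `[t₀, τ]`. -/
noncomputable def neumannTerm (L : ℝ → H →L[ℝ] H) (t₀ τ : ℝ) (F : ℝ → Ω → H) :
    ℕ → ℝ → Ω → H
  | 0 => F
  | k + 1 => fun t ω =>
      (Icc t₀ τ).indicator (fun t => ∫ s in t₀..t, L s (neumannTerm L t₀ τ F k s ω)) t

variable {L : ℝ → H →L[ℝ] H} {t₀ τ c : ℝ} {F : ℝ → Ω → H}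

omit [FiniteDimensional ℝ H] [MeasurableSpace H] [BorelSpace H] [MeasurableSpace Ω] in
theorem neumannTerm_succ (k : ℕ) (t : ℝ) (ω : Ω) : neumannTerm L t₀ τ F (k + 1) t ω =
    (Icc t₀ τ).indicator (fun t => ∫ s in t₀..t, L s (neumannTerm L t₀ τ F k s ω)) t := rfl

theorem measurable_neumannTerm (hL : Measurable L) (hF : Measurable fun p : ℝ × Ω => F p.1 p.2)
    (k : ℕ) : Measurable fun p : ℝ × Ω => neumannTerm L t₀ τ F k p.1 p.2 := by
  induction k with
  | zero => exact hF
  | succ k ih =>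
    exact Measurable.indicator (f := fun p : ℝ × Ω =>
      ∫ s in t₀..p.1, L s (neumannTerm L t₀ τ F k s p.2))
      (measurable_primitive (F := fun s ω => L s (neumannTerm L t₀ τ F k s ω))
        (measurable_clm_apply_uncurry hL ih) t₀)
      (measurable_fst measurableSet_Icc)

-- The first integration replaces the merely integrable `F` by the bound `c ∫ ‖F‖`; each later one
-- integrates a power of `t - t₀` and so produces the factorial. No restriction on `t` is needed,
-- since these terms vanish outside the interval.
omit [FiniteDimensional ℝ H] [MeasurableSpace H] [BorelSpace H] [MeasurableSpace Ω] in
theorem norm_neumannTerm_le (hc : ∀ t ∈ Icc t₀ τ, ‖L t‖ ≤ c) (hc₀ : 0 ≤ c) {ω : Ω}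
    (hF : IntegrableOn (fun s => F s ω) (Icc t₀ τ)) (k : ℕ) (t : ℝ) :
    ‖neumannTerm L t₀ τ F (k + 1) t ω‖ ≤
      c * (∫ s in Icc t₀ τ, ‖F s ω‖) * ((c * (τ - t₀)) ^ k / k.factorial) := by
  set J := ∫ s in Icc t₀ τ, ‖F s ω‖ with hJ
  have hJ₀ : 0 ≤ J := integral_nonneg fun _ => norm_nonneg _
  have key : ∀ k : ℕ, ∀ t ∈ Icc t₀ τ, ‖neumannTerm L t₀ τ F (k + 1) t ω‖ ≤
      c * J * ((c * (t - t₀)) ^ k / k.factorial) := by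
    intro k
    induction k with
    | zero =>
      intro t ht
      simp only [neumannTerm_succ, indicator_of_mem ht, pow_zero, Nat.factorial_zero, Nat.cast_one,
        div_one, mul_one]
      rw [intervalIntegral.integral_of_le ht.1, hJ, ← integral_const_mul]
      have hsub : Ioc t₀ t ⊆ Icc t₀ τ := Ioc_subset_Icc_self.trans (Icc_subset_Icc_right ht.2)
      refine (norm_integral_le_of_norm_le ((hF.mono_set hsub).norm.const_mul c) ?_).trans
        (setIntegral_mono_set (hF.norm.const_mul c) (ae_of_all _ fun s =>
          mul_nonneg hc₀ (norm_nonneg _)) hsub.eventuallyLE)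
      filter_upwards [ae_restrict_mem measurableSet_Ioc] with s hs
      exact (L s).le_of_opNorm_le (hc s (hsub hs)) _
    | succ k ih =>
      intro t ht
      rw [neumannTerm_succ, indicator_of_mem ht]
      have hder : ∀ x ∈ uIcc t₀ t, HasDerivAt
          (fun x => c * J * ((c * (x - t₀)) ^ (k + 1) / (k + 1).factorial))
          (c * (c * J * ((c * (x - t₀)) ^ k / k.factorial))) x := by
        intro x _
        have h1 := ((((hasDerivAt_id x).sub_const t₀).const_mul c).pow (k + 1)).div_const
          ((k + 1).factorial : ℝ) |>.const_mul (c * J)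
        convert! h1 using 1
        have : (k.factorial : ℝ) ≠ 0 := by positivity
        rw [Nat.factorial_succ]
        push_cast
        simp
        field_simp
      have hcont : Continuous fun x => c * (c * J * ((c * (x - t₀)) ^ k / k.factorial)) := by
        fun_prop
      have hint := intervalIntegral.integral_eq_sub_of_hasDerivAt hder
        (hcont.intervalIntegrable _ _)
      simp only [sub_self, mul_zero, ne_eq, Nat.add_eq_zero_iff, one_ne_zero, and_false,
        not_false_eq_true, zero_pow, zero_div, sub_zero] at hint
      rw [← hint]
      refine intervalIntegral.norm_integral_le_of_norm_le ht.1 (ae_of_all _ fun s hs => ?_)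
        (hcont.intervalIntegrable _ _)
      have hs' : s ∈ Icc t₀ τ := ⟨hs.1.le, hs.2.trans ht.2⟩
      exact ((L s).le_of_opNorm_le (hc s hs') _).trans (mul_le_mul_of_nonneg_left (ih s hs') hc₀)
  by_cases ht : t ∈ Icc t₀ τ
  · refine (key k t ht).trans ?_
    have : 0 ≤ t - t₀ := sub_nonneg.2 ht.1
    have := ht.2
    gcongr
  · rw [neumannTerm_succ, indicator_of_notMem ht, norm_zero]
    -- Here only nonnegativity of the bound is at stake. If `τ < t₀`, the power may be negative, but
    -- then `J = 0`.
    by_cases h : t₀ ≤ τ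
    · have : 0 ≤ τ - t₀ := sub_nonneg.2 h
      positivity
    · have : J = 0 := by rw [hJ, Icc_eq_empty h]; simp
      simp [this]

theorem summable_neumannBound (a b : ℝ) : Summable fun k : ℕ => a * (b ^ k / k.factorial) :=
  (Real.summable_pow_div_factorial b).mul_left a

/-- The linear integral equation `Δ = X₀ + ∫ L Δ + N` with measurable random data has a measurable
solution. -/
theorem exists_measurable_solution {P : Measure Ω} [SFinite P] (hL : Measurable L)
    (hc : ∀ t ∈ Icc t₀ τ, ‖L t‖ ≤ c) {N : ℝ → Ω → H}
    (hN : Measurable fun p : ℝ × Ω => N p.1 p.2)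
    (hNi : ∀ᵐ ω ∂P, IntegrableOn (fun s => N s ω) (Icc t₀ τ)) :
    ∃ Δ : ℝ → Ω → H, Measurable (fun p : ℝ × Ω => Δ p.1 p.2) ∧
      (∀ᵐ ω ∂P, IntegrableOn (fun s => Δ s ω) (Icc t₀ τ)) ∧
      ∀ᵐ ω ∂P, ∀ t ∈ Icc t₀ τ, Δ t ω = (∫ s in t₀..t, L s (Δ s ω)) + N t ω := by
  wlog hle : t₀ ≤ τ
  · exact ⟨fun _ _ => 0, measurable_const, by simp [Icc_eq_empty hle], by simp [Icc_eq_empty hle]⟩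
  have hc₀ : 0 ≤ c := (norm_nonneg _).trans (hc t₀ (left_mem_Icc.2 hle))
  -- Replacing the forcing by zero on the measurable null set of paths where it is not integrable
  -- lets the series converge for every `ω`, so that its sum is measurable.
  set good : Set Ω := {ω | ∫⁻ s in Icc t₀ τ, ‖N s ω‖ₑ < ⊤} with hgood
  have hgm : MeasurableSet good :=
    measurableSet_lt ((hN.comp measurable_swap).enorm.lintegral_prod_right'
      (ν := volume.restrict (Icc t₀ τ))) measurable_const
  set F : ℝ → Ω → H := fun t ω => good.indicator (fun ω => N t ω) ω with hFdef
  have hF : Measurable fun p : ℝ × Ω => F p.1 p.2 :=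
    Measurable.indicator hN (measurable_snd hgm)
  have hmem : ∀ᵐ ω ∂P, ω ∈ good := by
    filter_upwards [hNi] with ω hω using hω.2
  have hFi : ∀ ω, IntegrableOn (fun s => F s ω) (Icc t₀ τ) := by
    intro ω
    by_cases h : ω ∈ good
    · simp only [hFdef, indicator_of_mem h]
      exact ⟨(hN.comp (measurable_id.prodMk measurable_const)).aestronglyMeasurable, h⟩
    · simp only [hFdef, indicator_of_notMem h]
      exact integrableOn_zero
  set T := neumannTerm L t₀ τ F with hT
  have hTm : ∀ k, Measurable fun p : ℝ × Ω => T k p.1 p.2 := measurable_neumannTerm hL hF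
  have hTb := fun ω k t => norm_neumannTerm_le (F := F) hc hc₀ (hFi ω) k t
  have hsum : ∀ t ω, Summable fun k => T (k + 1) t ω := fun t ω =>
    Summable.of_norm_bounded (summable_neumannBound _ _) fun k => hTb ω k t
  -- The sum starts at index `k + 1`: the zeroth term `F` is integrable but possibly unbounded, and
  -- is added separately.
  set S : ℝ → Ω → H := fun t ω => ∑' k, T (k + 1) t ω with hS
  have hSm : Measurable fun p : ℝ × Ω => S p.1 p.2 := by
    refine measurable_of_tendsto_metrizable (f := fun n (p : ℝ × Ω) =>
      ∑ k ∈ Finset.range n, T (k + 1) p.1 p.2)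
      (fun n => Finset.measurable_fun_sum _ fun k _ => hTm (k + 1)) ?_
    exact tendsto_pi_nhds.2 fun p => (hsum p.1 p.2).hasSum.tendsto_sum_nat
  have hSb : ∀ ω, ∃ b, ∀ t, ‖S t ω‖ ≤ b := fun ω =>
    ⟨_, fun t => tsum_of_norm_bounded (summable_neumannBound _ _).hasSum fun k => hTb ω k t⟩
  have hSi : ∀ ω, IntegrableOn (fun s => S s ω) (Icc t₀ τ) := fun ω => by
    obtain ⟨b, hb⟩ := hSb ω
    exact Measure.integrableOn_of_bounded (M := b) (by simp)
      (hSm.comp (measurable_id.prodMk measurable_const)).aestronglyMeasurable (ae_of_all _ hb)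
  refine ⟨fun t ω => F t ω + S t ω, hF.add hSm, ae_of_all _ fun ω => (hFi ω).add (hSi ω), ?_⟩
  filter_upwards [hmem] with ω hω t ht
  have hsub : Ioc t₀ t ⊆ Icc t₀ τ := Ioc_subset_Icc_self.trans (Icc_subset_Icc_right ht.2)
  have hLi : ∀ {G : ℝ → Ω → H}, Measurable (fun p : ℝ × Ω => G p.1 p.2) →
      IntegrableOn (fun s => G s ω) (Icc t₀ τ) →
      IntervalIntegrable (fun s => L s (G s ω)) volume t₀ t := by
    intro G hG hGi
    rw [intervalIntegrable_iff_integrableOn_Ioc_of_le ht.1]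
    refine ((hGi.mono_set hsub).norm.const_mul c).mono'
      ((measurable_clm_apply_uncurry hL hG).comp
        (measurable_id.prodMk measurable_const)).aestronglyMeasurable ?_
    filter_upwards [ae_restrict_mem measurableSet_Ioc] with s hs
    exact (L s).le_of_opNorm_le (hc s (hsub hs)) _
  have h1 : HasSum (fun k => ∫ s in t₀..t, L s (T (k + 1) s ω)) (∫ s in t₀..t, L s (S s ω)) := by
    refine intervalIntegral.hasSum_integral_of_dominated_convergence
      (fun k _ => c * (c * (∫ s in Icc t₀ τ, ‖F s ω‖) * ((c * (τ - t₀)) ^ k / k.factorial)))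
      (fun k => ((measurable_clm_apply_uncurry hL (hTm (k + 1))).comp
        (measurable_id.prodMk measurable_const)).aestronglyMeasurable) ?_ ?_ ?_ ?_
    · refine fun k => ae_of_all _ fun s hs => ?_
      rw [uIoc_of_le ht.1] at hs
      exact ((L s).le_of_opNorm_le (hc s (hsub hs)) _).trans
        (mul_le_mul_of_nonneg_left (hTb ω k s) hc₀)
    · exact ae_of_all _ fun s hs => (summable_neumannBound _ _).mul_left c
    · exact intervalIntegrable_const
    · exact ae_of_all _ fun s hs => (hsum s ω).hasSum.mapL (L s)
  have h2 : S t ω = (∫ s in t₀..t, L s (F s ω)) + ∫ s in t₀..t, L s (S s ω) := by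
    have hrec : ∀ k, T (k + 1) t ω = ∫ s in t₀..t, L s (T k s ω) := fun k => by
      simp only [hT, neumannTerm_succ, indicator_of_mem ht]
    rw [← h1.tsum_eq, hS]
    simp only
    rw [(hsum t ω).tsum_eq_zero_add, hrec 0]
    congr 1
    exact tsum_congr fun k => hrec (k + 1)
  simp only [map_add]
  rw [intervalIntegral.integral_add (hLi hF (hFi ω)) (hLi hSm (hSi ω)), ← h2, add_comm]
  simp only [hFdef, indicator_of_mem hω]

end Picard

/-! ### Second moments of solutions of linear stochastic integral equations -/

/-- Cauchy-Schwarz against the constant function, obtained by expanding `∫ (T f - I)² ≥ 0` and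
dividing by the total mass `T`; hence the separate case `T = 0`. -/
theorem sq_integral_le_measureReal_mul {α : Type*} [MeasurableSpace α] {ν : Measure α}
    [IsFiniteMeasure ν] {f : α → ℝ} (hf : MemLp f 2 ν) :
    (∫ x, f x ∂ν) ^ 2 ≤ ν.real univ * ∫ x, f x ^ 2 ∂ν := by
  set T := ν.real univ with hT
  set I := ∫ x, f x ∂ν with hI
  rcases (measureReal_nonneg : 0 ≤ ν.real univ).eq_or_lt with h | h
  · have : ν = 0 := by
      rwa [eq_comm, measureReal_def, ENNReal.toReal_eq_zero_iff, or_iff_left (measure_ne_top _ _),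
        Measure.measure_univ_eq_zero] at h
    simp [hI, hT, this]
  · have hf1 : Integrable f ν := hf.integrable one_le_two
    have h0 : 0 ≤ ∫ x, (T * f x - I) ^ 2 ∂ν := integral_nonneg fun _ => sq_nonneg _
    have h1 : ∫ x, (T * f x - I) ^ 2 ∂ν = T * (T * ∫ x, f x ^ 2 ∂ν) - T * I ^ 2 := by
      have : ∀ x, (T * f x - I) ^ 2 = T ^ 2 * f x ^ 2 - 2 * T * I * f x + I ^ 2 := fun x => by ring
      simp_rw [this]
      have hi₁ : Integrable (fun x => T ^ 2 * f x ^ 2) ν := hf.integrable_sq.const_mul _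
      have hi₂ : Integrable (fun x => 2 * T * I * f x) ν := hf1.const_mul _
      rw [integral_add (f := fun x => T ^ 2 * f x ^ 2 - 2 * T * I * f x) (hi₁.sub hi₂)
        (integrable_const _), integral_sub hi₁ hi₂,
        integral_const_mul, integral_const_mul, integral_const, ← hI, smul_eq_mul, ← hT]
      ring
    rw [h1, ← mul_sub] at h0
    have := (mul_nonneg_iff_of_pos_left h).1 h0
    linarith

/-! ### Correlation operators -/

section Cross

variable {H : Type*} [NormedAddCommGroup H] [InnerProductSpace ℝ H]
  {α : Type*} [MeasurableSpace α] {μ : Measure α} {X X' Y Y' : α → H}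

theorem integrable_outer (hX : MemLp X 2 μ) (hY : MemLp Y 2 μ) :
    Integrable (fun a => outer (X a) (Y a)) μ := by
  refine (hX.norm.integrable_mul hY.norm).mono'
    (aestronglyMeasurable_outer hX.aestronglyMeasurable hY.aestronglyMeasurable) ?_
  exact ae_of_all _ fun a => by simp

/-- The operator `E[X ⟨Y, ·⟩]`. -/
noncomputable def cross (μ : Measure α) (X Y : α → H) : H →L[ℝ] H := ∫ a, outer (X a) (Y a) ∂μ

theorem secondMoment_eq_cross (X : α → H) : secondMoment μ X = cross μ X X := by
  simp only [secondMoment, cross, outer_eq_rankOne]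

theorem cross_sub_left (hX : MemLp X 2 μ) (hX' : MemLp X' 2 μ) (hY : MemLp Y 2 μ) :
    cross μ (fun a => X a - X' a) Y = cross μ X Y - cross μ X' Y := by
  simp only [cross, map_sub, sub_apply]
  exact integral_sub (integrable_outer hX hY) (integrable_outer hX' hY)

theorem cross_sub_right (hX : MemLp X 2 μ) (hY : MemLp Y 2 μ) (hY' : MemLp Y' 2 μ) :
    cross μ X (fun a => Y a - Y' a) = cross μ X Y - cross μ X Y' := by
  simp only [cross, map_sub]
  exact integral_sub (integrable_outer hX hY) (integrable_outer hX hY')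

variable [CompleteSpace H]

theorem inner_cross (hX : MemLp X 2 μ) (hY : MemLp Y 2 μ) (a b : H) :
    ⟪a, cross μ X Y b⟫_ℝ = ∫ x, ⟪a, X x⟫_ℝ * ⟪Y x, b⟫_ℝ ∂μ := by
  rw [← matrixCoeff_apply, cross,
    ← ContinuousLinearMap.integral_comp_comm _ (integrable_outer hX hY)]
  simp only [matrixCoeff_apply, inner_outer]

theorem adjoint_cross (hX : MemLp X 2 μ) (hY : MemLp Y 2 μ) :
    ContinuousLinearMap.adjoint (cross μ X Y) = cross μ Y X := by
  refine clm_ext_inner fun a b => ?_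
  rw [ContinuousLinearMap.adjoint_inner_right, real_inner_comm, inner_cross hX hY,
    inner_cross hY hX]
  simp only [real_inner_comm, mul_comm]

theorem comp_cross (hX : MemLp X 2 μ) (hY : MemLp Y 2 μ) (T : H →L[ℝ] H) :
    cross μ (fun a => T (X a)) Y = T ∘L cross μ X Y := by
  refine clm_ext_inner fun a b => ?_
  rw [inner_cross (X := fun a => T (X a)) (T.comp_memLp' hX) hY, ContinuousLinearMap.comp_apply,
    ← ContinuousLinearMap.adjoint_inner_left, inner_cross hX hY]
  simp only [ContinuousLinearMap.adjoint_inner_left]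

theorem cross_comp_adjoint (hX : MemLp X 2 μ) (hY : MemLp Y 2 μ) (T : H →L[ℝ] H) :
    cross μ X (fun a => T (Y a)) = cross μ X Y ∘L ContinuousLinearMap.adjoint T := by
  refine clm_ext_inner fun a b => ?_
  rw [inner_cross (Y := fun a => T (Y a)) hX (T.comp_memLp' hY), ContinuousLinearMap.comp_apply,
    inner_cross hX hY]
  simp only [ContinuousLinearMap.adjoint_inner_right]

end Cross

/-! ### Moment bounds and the Lyapunov equation for linear systems -/

section System

variable {H : Type*} [NormedAddCommGroup H] [InnerProductSpace ℝ H] [FiniteDimensional ℝ H]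
  [MeasurableSpace H] [BorelSpace H] {Ω : Type*} [MeasurableSpace Ω] {P : Measure Ω}
  [IsProbabilityMeasure P] {t₀ τ c : ℝ} {L G : ℝ → H →L[ℝ] H} {X₀ : Ω → H}
  {F N Δ : ℝ → Ω → H}

/-- `E‖X‖²` is the trace of the second moment, and each of its diagonal entries in an orthonormal
basis is at most the operator norm. -/
theorem integral_norm_sq_le_opNorm {X : Ω → H} (hX : MemLp X 2 P) :
    ∫ ω, ‖X ω‖ ^ 2 ∂P ≤ Module.finrank ℝ H * ‖cross P X X‖ := by
  set b := stdOrthonormalBasis ℝ H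
  have h1 : ∀ ω, ‖X ω‖ ^ 2 = ∑ i, ⟪b i, X ω⟫_ℝ * ⟪X ω, b i⟫_ℝ := fun ω => by
    rw [← b.sum_sq_norm_inner_right]
    refine Finset.sum_congr rfl fun i _ => ?_
    rw [real_inner_comm (b i) (X ω), Real.norm_eq_abs, sq_abs, sq]
  simp_rw [h1]
  rw [integral_finsetSum]
  · simp_rw [← inner_cross hX hX]
    refine (Finset.sum_le_card_nsmul _ _ ‖cross P X X‖ fun i _ => ?_).trans (by simp)
    refine (real_inner_le_norm _ _).trans ?_
    rw [b.norm_eq_one, one_mul]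
    exact ((cross P X X).le_opNorm _).trans (by simp [b.norm_eq_one])
  · intro i _
    exact (hX.const_inner (b i)).integrable_mul (hX.inner_const (b i))

/-- The product of the time interval with the probability space. -/
noncomputable abbrev timeProd (P : Measure Ω) (t₀ τ : ℝ) : Measure (ℝ × Ω) :=
  (volume.restrict (Icc t₀ τ)).prod P

theorem ae_timeProd_mem : ∀ᵐ p ∂timeProd P t₀ τ, p.1 ∈ Icc t₀ τ :=
  Measure.quasiMeasurePreserving_fst.ae (ae_restrict_mem measurableSet_Icc)

theorem memLp_timeProd_of_bound (hF : Measurable fun p : ℝ × Ω => F p.1 p.2) {D : ℝ}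
    (hF2 : ∀ t ∈ Icc t₀ τ, MemLp (F t) 2 P) (hD : ∀ t ∈ Icc t₀ τ, ∫ ω, ‖F t ω‖ ^ 2 ∂P ≤ D) :
    MemLp (fun p : ℝ × Ω => F p.1 p.2) 2 (timeProd P t₀ τ) := by
  rw [memLp_two_iff_integrable_sq_norm hF.aestronglyMeasurable,
    integrable_prod_iff (hF.norm.pow_const 2).aestronglyMeasurable]
  constructor
  · filter_upwards [ae_restrict_mem measurableSet_Icc] with t ht
    exact (hF2 t ht).norm.integrable_sq
  · refine Measure.integrableOn_of_bounded (M := D) (by simp)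
      ((hF.norm.pow_const 2).norm.stronglyMeasurable.integral_prod_right').aestronglyMeasurable ?_
    filter_upwards [ae_restrict_mem measurableSet_Icc] with t ht
    rw [Real.norm_of_nonneg (integral_nonneg fun _ => norm_nonneg _)]
    simpa using hD t ht

theorem memLp_clm_apply (hL : Measurable L) (hc : ∀ t ∈ Icc t₀ τ, ‖L t‖ ≤ c)
    (hF : Measurable fun p : ℝ × Ω => F p.1 p.2)
    (hF2 : MemLp (fun p : ℝ × Ω => F p.1 p.2) 2 (timeProd P t₀ τ)) :
    MemLp (fun p : ℝ × Ω => L p.1 (F p.1 p.2)) 2 (timeProd P t₀ τ) := by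
  refine hF2.of_le_mul (c := c) (measurable_clm_apply_uncurry hL hF).aestronglyMeasurable ?_
  filter_upwards [ae_timeProd_mem] with p hp
  exact (L p.1).le_of_opNorm_le (hc _ hp) _

theorem integral_intervalIntegral_swap {V : Type*} [NormedAddCommGroup V] [NormedSpace ℝ V]
    {f : ℝ → Ω → V} (hf : Integrable (fun p : ℝ × Ω => f p.1 p.2) (timeProd P t₀ τ)) {t : ℝ}
    (ht : t ∈ Icc t₀ τ) :
    ∫ ω, (∫ s in t₀..t, f s ω) ∂P = ∫ s in t₀..t, ∫ ω, f s ω ∂P := by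
  simp only [intervalIntegral.integral_of_le ht.1]
  refine (integral_integral_swap (f := f) ?_).symm
  refine hf.mono_measure (Measure.prod_mono (Measure.restrict_mono_set _ ?_) le_rfl)
  exact Ioc_subset_Icc_self.trans (Icc_subset_Icc_right ht.2)

theorem intervalIntegrable_of_Icc {V : Type*} [NormedAddCommGroup V] {f : ℝ → V}
    (hf : IntegrableOn f (Icc t₀ τ)) {t : ℝ} (ht : t ∈ Icc t₀ τ) :
    IntervalIntegrable f volume t₀ t :=
  (intervalIntegrable_iff_integrableOn_Icc_of_le ht.1).2
    (hf.mono_set (Icc_subset_Icc_right ht.2))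

theorem integrableOn_clm_apply (hL : Measurable L) (hc : ∀ t ∈ Icc t₀ τ, ‖L t‖ ≤ c) {x : ℝ → H}
    (hx : IntegrableOn x (Icc t₀ τ)) : IntegrableOn (fun t => L t (x t)) (Icc t₀ τ) := by
  refine (hx.norm.const_mul c).mono' ?_ ?_
  · exact isBoundedBilinearMap_apply.continuous.comp_aestronglyMeasurable
      (hL.aestronglyMeasurable.prodMk hx.aestronglyMeasurable)
  · filter_upwards [ae_restrict_mem measurableSet_Icc] with s hs
    exact (L s).le_of_opNorm_le (hc s hs) _

theorem integrableOn_clm_comp (hL : Measurable L) (hc : ∀ t ∈ Icc t₀ τ, ‖L t‖ ≤ c)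
    {S : ℝ → H →L[ℝ] H} (hS : IntegrableOn S (Icc t₀ τ)) :
    IntegrableOn (fun t => L t ∘L S t) (Icc t₀ τ) := by
  refine (hS.norm.const_mul c).mono' ?_ ?_
  · exact isBoundedBilinearMap_comp.continuous.comp_aestronglyMeasurable
      (hL.aestronglyMeasurable.prodMk hS.aestronglyMeasurable)
  · filter_upwards [ae_restrict_mem measurableSet_Icc] with s hs
    exact ((L s).opNorm_comp_le _).trans (mul_le_mul_of_nonneg_right (hc s hs) (norm_nonneg _))

/-- Taking adjoints, as a real linear map. -/
noncomputable def adjointL : (H →L[ℝ] H) →L[ℝ] H →L[ℝ] H :=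
  LinearMap.mkContinuous
    { toFun := fun T => ContinuousLinearMap.adjoint T
      map_add' := fun _ _ => map_add _ _ _
      map_smul' := fun _ _ => by simp } 1 (by simp)

theorem adjointL_apply (T : H →L[ℝ] H) : adjointL T = ContinuousLinearMap.adjoint T := rfl

theorem integrableOn_comp_adjoint (hL : Measurable L) (hc : ∀ t ∈ Icc t₀ τ, ‖L t‖ ≤ c)
    {S : ℝ → H →L[ℝ] H} (hS : IntegrableOn S (Icc t₀ τ)) :
    IntegrableOn (fun t => S t ∘L ContinuousLinearMap.adjoint (L t)) (Icc t₀ τ) := by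
  have := adjointL.integrable_comp
    (integrableOn_clm_comp hL hc (adjointL.integrable_comp hS))
  refine this.congr (ae_of_all _ fun t => ?_)
  simp [adjointL_apply, ContinuousLinearMap.adjoint_comp]

/-- Measurable square-integrable processes `N` with orthogonal increments, uncorrelated with the
initial value `X₀`, and with covariance `G`. -/
structure IsAdditiveNoise (P : Measure Ω) (t₀ τ : ℝ) (G : ℝ → H →L[ℝ] H) (X₀ : Ω → H)
    (N : ℝ → Ω → H) : Prop where
  measurable : Measurable fun p : ℝ × Ω => N p.1 p.2
  memLp : ∀ t ∈ Icc t₀ τ, MemLp (N t) 2 P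
  cross_init : ∀ t ∈ Icc t₀ τ, cross P X₀ (N t) = 0
  cross_eq : ∀ s t, t₀ ≤ s → s ≤ t → t ≤ τ → cross P (N s) (N t) = G s
  bound : ∃ g, ∀ t ∈ Icc t₀ τ, ‖G t‖ ≤ g

theorem IsAdditiveNoise.memLp_timeProd (hN : IsAdditiveNoise P t₀ τ G X₀ N) :
    MemLp (fun p : ℝ × Ω => N p.1 p.2) 2 (timeProd P t₀ τ) := by
  obtain ⟨g, hg⟩ := hN.bound
  refine memLp_timeProd_of_bound (D := Module.finrank ℝ H * g) hN.measurable hN.memLp fun t ht => ?_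
  refine (integral_norm_sq_le_opNorm (hN.memLp t ht)).trans ?_
  rw [hN.cross_eq t t ht.1 le_rfl ht.2]
  exact mul_le_mul_of_nonneg_left (hg t ht) (Nat.cast_nonneg _)

/-- The data of a linear stochastic integral equation `Δ = X₀ + ∫ L Δ + N`. -/
structure IsLinearSystem (P : Measure Ω) (t₀ τ c : ℝ) (L G : ℝ → H →L[ℝ] H) (X₀ : Ω → H)
    (N Δ : ℝ → Ω → H) : Prop where
  noise : IsAdditiveNoise P t₀ τ G X₀ N
  memLp_init : MemLp X₀ 2 P
  measurable_coeff : Measurable L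
  bound : ∀ t ∈ Icc t₀ τ, ‖L t‖ ≤ c
  nonneg : 0 ≤ c
  measurable : Measurable fun p : ℝ × Ω => Δ p.1 p.2
  integrable : ∀ᵐ ω ∂P, IntegrableOn (fun s => Δ s ω) (Icc t₀ τ)
  eq : ∀ᵐ ω ∂P, ∀ t ∈ Icc t₀ τ, Δ t ω = X₀ ω + (∫ s in t₀..t, L s (Δ s ω)) + N t ω

namespace IsLinearSystem

variable (h : IsLinearSystem P t₀ τ c L G X₀ N Δ)
include h

/-- The difference `X = Δ - N` satisfies `X = X₀ + ∫ L (N + X)`, so Grönwall bounds it on each path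
by `(‖X₀‖ + c ∫ ‖N‖) exp (c (τ - t₀))`, which is square-integrable by Cauchy-Schwarz. This is the
source of all moment bounds for `Δ`, whose paths are only assumed integrable. -/
theorem exists_dominating : ∃ Z : Ω → ℝ, MemLp Z 2 P ∧
    ∀ᵐ ω ∂P, ∀ t ∈ Icc t₀ τ, ‖Δ t ω - N t ω‖ ≤ Z ω := by
  have hN2 := h.noise.memLp_timeProd
  set J : Ω → ℝ := fun ω => ∫ s in Icc t₀ τ, ‖N s ω‖ with hJ
  have hJm : AEStronglyMeasurable J P :=
    (h.noise.measurable.norm.stronglyMeasurable.integral_prod_left').aestronglyMeasurable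
  have hsq : Integrable (fun p : ℝ × Ω => ‖N p.1 p.2‖ ^ 2) (timeProd P t₀ τ) :=
    hN2.norm.integrable_sq
  have hJ2 : MemLp J 2 P := by
    rw [memLp_two_iff_integrable_sq hJm]
    refine (hsq.integral_prod_right.const_mul ((volume.restrict (Icc t₀ τ)).real univ)).mono'
      (hJm.pow 2) ?_
    filter_upwards [hsq.prod_left_ae] with ω hω
    rw [Real.norm_of_nonneg (sq_nonneg _)]
    refine sq_integral_le_measureReal_mul ?_
    rw [memLp_two_iff_integrable_sq]
    · exact hω
    · exact (h.noise.measurable.comp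
        (measurable_id.prodMk measurable_const)).norm.aestronglyMeasurable
  refine ⟨fun ω => (‖X₀ ω‖ + c * J ω) * Real.exp (c * (τ - t₀)),
    (h.memLp_init.norm.add (hJ2.const_mul c)).mul_const _, ?_⟩
  have hNi : ∀ᵐ ω ∂P, IntegrableOn (fun s => N s ω) (Icc t₀ τ) :=
    (hN2.integrable one_le_two).prod_left_ae
  filter_upwards [h.eq, h.integrable, hNi] with ω he hi hn t ht
  have hX : ∀ t ∈ Icc t₀ τ, Δ t ω - N t ω = X₀ ω + ∫ s in t₀..t, L s (Δ s ω) := fun t ht => by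
    rw [he t ht]; abel
  have hJ₀ : 0 ≤ J ω := integral_nonneg fun _ => norm_nonneg _
  refine (le_mul_exp_of_le_add_mul_integral (u := fun t => ‖Δ t ω - N t ω‖)
    (a := ‖X₀ ω‖ + c * J ω) h.nonneg (hi.sub hn).norm (fun r hr => ?_) t ht).trans ?_
  · rw [hX r hr, add_assoc]
    refine (norm_add_le _ _).trans (add_le_add le_rfl ?_)
    have hb : ‖∫ s in t₀..r, L s (Δ s ω)‖ ≤ ∫ s in t₀..r, c * (‖N s ω‖ + ‖Δ s ω - N s ω‖) := by
      refine intervalIntegral.norm_integral_le_of_norm_le hr.1 (ae_of_all _ fun s hs => ?_)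
        (intervalIntegrable_of_Icc ((hn.norm.add (hi.sub hn).norm).const_mul c) hr)
      refine ((L s).le_of_opNorm_le (h.bound s ⟨hs.1.le, hs.2.trans hr.2⟩) _).trans ?_
      refine mul_le_mul_of_nonneg_left ?_ h.nonneg
      simpa using norm_add_le (N s ω) (Δ s ω - N s ω)
    refine hb.trans ?_
    rw [intervalIntegral.integral_const_mul, intervalIntegral.integral_add
      (g := fun s => ‖Δ s ω - N s ω‖)
      (intervalIntegrable_of_Icc hn.norm hr) (intervalIntegrable_of_Icc (hi.sub hn).norm hr),
      mul_add]
    refine add_le_add (mul_le_mul_of_nonneg_left ?_ h.nonneg) le_rfl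
    rw [intervalIntegral.integral_of_le hr.1]
    exact setIntegral_mono_set hn.norm (ae_of_all _ fun s => norm_nonneg _)
      (Ioc_subset_Icc_self.trans (Icc_subset_Icc_right hr.2)).eventuallyLE
  · have := h.nonneg
    have := ht.2
    gcongr

theorem memLp_sub : ∀ t ∈ Icc t₀ τ, MemLp (fun ω => Δ t ω - N t ω) 2 P := by
  obtain ⟨Z, hZ, hle⟩ := h.exists_dominating
  intro t ht
  refine hZ.of_le_mul (c := 1) ((h.measurable.comp (measurable_const.prodMk measurable_id)).sub
    (h.noise.measurable.comp (measurable_const.prodMk measurable_id))).aestronglyMeasurable ?_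
  filter_upwards [hle] with ω hω
  rw [one_mul]
  exact (hω t ht).trans (le_abs_self _)

theorem memLp : ∀ t ∈ Icc t₀ τ, MemLp (Δ t) 2 P := fun t ht => by
  exact ((h.memLp_sub t ht).add (h.noise.memLp t ht)).ae_eq (ae_of_all _ fun ω => by simp)

theorem memLp_timeProd_sub :
    MemLp (fun p : ℝ × Ω => Δ p.1 p.2 - N p.1 p.2) 2 (timeProd P t₀ τ) := by
  obtain ⟨Z, hZ, hle⟩ := h.exists_dominating
  refine memLp_timeProd_of_bound (F := fun t ω => Δ t ω - N t ω) (D := ∫ ω, ‖Z ω‖ ^ 2 ∂P)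
    (h.measurable.sub h.noise.measurable) h.memLp_sub fun t ht => ?_
  refine integral_mono_ae (h.memLp_sub t ht).norm.integrable_sq hZ.norm.integrable_sq ?_
  filter_upwards [hle] with ω hω
  exact pow_le_pow_left₀ (norm_nonneg _) ((hω t ht).trans (le_abs_self _)) 2

theorem memLp_timeProd : MemLp (fun p : ℝ × Ω => Δ p.1 p.2) 2 (timeProd P t₀ τ) := by
  exact (h.memLp_timeProd_sub.add h.noise.memLp_timeProd).ae_eq (ae_of_all _ fun p => by simp)

/-- Multiplying the equation by a fixed `Y` and applying Fubini leaves a deterministic linear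
equation, forced only by the correlations of `X₀` and `N t` with `Y`. -/
theorem cross_integral_left {Y : Ω → H} (hY : MemLp Y 2 P) :
    IntegrableOn (fun s => cross P (Δ s) Y) (Icc t₀ τ) ∧
    ∀ t ∈ Icc t₀ τ, cross P (Δ t) Y = cross P X₀ Y + (∫ s in t₀..t, L s ∘L cross P (Δ s) Y)
      + cross P (N t) Y := by
  have hY' : MemLp (fun p : ℝ × Ω => Y p.2) 2 (timeProd P t₀ τ) := hY.comp_snd _
  have hΔ := h.memLp_timeProd
  refine ⟨(integrable_outer hΔ hY').integral_prod_left, fun t ht => ?_⟩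
  have hLi := integrable_outer
    (memLp_clm_apply (P := P) h.measurable_coeff h.bound h.measurable hΔ) hY'
  have e1 : (fun ω => outer (Δ t ω - N t ω) (Y ω)) =ᵐ[P]
      fun ω => outer (X₀ ω) (Y ω) + ∫ s in t₀..t, outer (L s (Δ s ω)) (Y ω) := by
    filter_upwards [h.eq, h.integrable] with ω he hi
    have hi' := intervalIntegrable_of_Icc (integrableOn_clm_apply h.measurable_coeff h.bound hi) ht
    rw [he t ht, add_sub_cancel_right, map_add, add_apply]
    congr 1
    exact (((outer (H := H)).flip (Y ω)).intervalIntegral_comp_comm hi').symm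
  have e2 : cross P (fun ω => Δ t ω - N t ω) Y = cross P X₀ Y +
      ∫ s in t₀..t, L s ∘L cross P (Δ s) Y := by
    have hsub := (integrable_outer (h.memLp_sub t ht) hY)
    have h0 := integrable_outer h.memLp_init hY
    rw [cross, integral_congr_ae e1, integral_add h0, integral_intervalIntegral_swap hLi ht]
    · refine congrArg (cross P X₀ Y + ·) (intervalIntegral.integral_congr fun s hs => ?_)
      rw [uIcc_of_le ht.1] at hs
      exact comp_cross (h.memLp s ⟨hs.1, hs.2.trans ht.2⟩) hY (L s)
    · refine (hsub.sub h0).congr ?_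
      filter_upwards [e1] with ω hω
      exact sub_eq_iff_eq_add'.2 hω
  rw [← e2, cross_sub_left (h.memLp t ht) (h.noise.memLp t ht) hY, sub_add_cancel]

/-- The correlation of the solution with the noise does not see future increments of the noise. -/
theorem cross_noise_eq (hc : 0 ≤ c) {t : ℝ} (ht : t ∈ Icc t₀ τ) :
    cross P (Δ t) (N t) = cross P (Δ t) (N τ) := by
  have hτ : τ ∈ Icc t₀ τ := ⟨ht.1.trans ht.2, le_rfl⟩
  obtain ⟨hi₁, he₁⟩ := h.cross_integral_left (h.noise.memLp t ht)
  obtain ⟨hi₂, he₂⟩ := h.cross_integral_left (h.noise.memLp τ hτ)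
  have hsub : Icc t₀ t ⊆ Icc t₀ τ := Icc_subset_Icc_right ht.2
  have hi := (hi₁.sub hi₂).mono_set hsub
  -- For `s ≤ t` both `N t` and `N τ` have correlation `G s` with `N s`, so the forcing cancels in
  -- the difference, which solves a homogeneous equation on `[t₀, t]`.
  refine sub_eq_zero.1 (eq_zero_of_norm_le_mul_integral (c := c) (t₀ := t₀) (τ := t)
    (u := fun s => cross P (Δ s) (N t) - cross P (Δ s) (N τ)) hc hi (fun s hs => ?_) t
    ⟨ht.1, le_rfl⟩)
  have hs' := hsub hs
  rw [he₁ s hs', he₂ s hs', h.noise.cross_eq s t hs.1 hs.2 ht.2,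
    h.noise.cross_eq s τ hs.1 hs'.2 le_rfl, h.noise.cross_init t ht, h.noise.cross_init τ hτ,
    add_sub_add_right_eq_sub, add_sub_add_left_eq_sub, ← intervalIntegral.integral_sub
    (intervalIntegrable_of_Icc (integrableOn_clm_comp h.measurable_coeff h.bound hi₁) hs')
    (intervalIntegrable_of_Icc (integrableOn_clm_comp h.measurable_coeff h.bound hi₂) hs'),
    ← intervalIntegral.integral_const_mul]
  refine intervalIntegral.norm_integral_le_of_norm_le hs.1 (ae_of_all _ fun r hr => ?_)
    ((intervalIntegrable_of_Icc hi hs).norm.const_mul c)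
  rw [← ContinuousLinearMap.comp_sub]
  exact ((L r).opNorm_comp_le _).trans (mul_le_mul_of_nonneg_right
    (h.bound r ⟨hr.1.le, hr.2.trans hs'.2⟩) (norm_nonneg _))

theorem integrableOn_cross_self : IntegrableOn (fun s => cross P (Δ s) (Δ s)) (Icc t₀ τ) :=
  (integrable_outer h.memLp_timeProd h.memLp_timeProd).integral_prod_left

/-- With the noise subtracted the paths are absolutely continuous, so the product rule has no
correction term. The term `G` of the Lyapunov equation appears only when `Δ - N` is expanded. -/
theorem cross_sub_self {t : ℝ} (ht : t ∈ Icc t₀ τ) :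
    cross P (fun ω => Δ t ω - N t ω) (fun ω => Δ t ω - N t ω) = cross P X₀ X₀ +
      ∫ s in t₀..t, (L s ∘L cross P (Δ s) (fun ω => Δ s ω - N s ω) +
        cross P (fun ω => Δ s ω - N s ω) (Δ s) ∘L ContinuousLinearMap.adjoint (L s)) := by
  have hΔ := h.memLp_timeProd
  have hX := h.memLp_timeProd_sub
  have hLΔ := memLp_clm_apply (P := P) h.measurable_coeff h.bound h.measurable hΔ
  have hi₁ := integrable_outer hLΔ hX
  have hi₂ := integrable_outer hX hLΔ
  have e1 : (fun ω => outer (Δ t ω - N t ω) (Δ t ω - N t ω)) =ᵐ[P]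
      fun ω => outer (X₀ ω) (X₀ ω) + ∫ s in t₀..t, (outer (L s (Δ s ω)) (Δ s ω - N s ω) +
        outer (Δ s ω - N s ω) (L s (Δ s ω))) := by
    filter_upwards [h.eq, h.integrable] with ω he hi
    have hi' := intervalIntegrable_of_Icc (integrableOn_clm_apply h.measurable_coeff h.bound hi) ht
    have hX : ∀ t ∈ Icc t₀ τ, Δ t ω - N t ω = X₀ ω + ∫ s in t₀..t, L s (Δ s ω) := fun t ht => by
      rw [he t ht, add_sub_cancel_right]
    rw [hX t ht, outer_add_integral hi']
    refine congrArg (outer (X₀ ω) (X₀ ω) + ·) (intervalIntegral.integral_congr fun s hs => ?_)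
    rw [uIcc_of_le ht.1] at hs
    simp only [hX s ⟨hs.1, hs.2.trans ht.2⟩]
  have hsub := integrable_outer (h.memLp_sub t ht) (h.memLp_sub t ht)
  have h0 := integrable_outer h.memLp_init h.memLp_init
  rw [cross, integral_congr_ae e1, integral_add h0, integral_intervalIntegral_swap
    (f := fun s ω => outer (L s (Δ s ω)) (Δ s ω - N s ω) + outer (Δ s ω - N s ω) (L s (Δ s ω)))
    (hi₁.add hi₂) ht]
  · refine congrArg (cross P X₀ X₀ + ·) (intervalIntegral.integral_congr fun s hs => ?_)
    rw [uIcc_of_le ht.1] at hs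
    have hs' : s ∈ Icc t₀ τ := ⟨hs.1, hs.2.trans ht.2⟩
    have hL := (L s).comp_memLp' (h.memLp s hs')
    rw [← comp_cross (h.memLp s hs') (h.memLp_sub s hs'),
      ← cross_comp_adjoint (h.memLp_sub s hs') (h.memLp s hs')]
    exact integral_add (integrable_outer hL (h.memLp_sub s hs'))
      (integrable_outer (h.memLp_sub s hs') hL)
  · refine (hsub.sub h0).congr ?_
    filter_upwards [e1] with ω hω
    exact sub_eq_iff_eq_add'.2 hω

/-- The **Lyapunov equation** for the second moment of the solution. -/
theorem cross_self_eq {t : ℝ} (ht : t ∈ Icc t₀ τ) :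
    cross P (Δ t) (Δ t) = cross P X₀ X₀ + (∫ s in t₀..t, (L s ∘L cross P (Δ s) (Δ s) +
      cross P (Δ s) (Δ s) ∘L ContinuousLinearMap.adjoint (L s))) + G t := by
  have hτ : τ ∈ Icc t₀ τ := ⟨ht.1.trans ht.2, le_rfl⟩
  have hNτ := h.noise.memLp τ hτ
  obtain ⟨hVi, hVe⟩ := h.cross_integral_left hNτ
  have hWi : IntegrableOn (fun s => cross P (N τ) (Δ s)) (Icc t₀ τ) := by
    refine (adjointL.integrable_comp hVi).congr ?_
    filter_upwards [ae_restrict_mem measurableSet_Icc] with s hs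
    exact adjoint_cross (h.memLp s hs) hNτ
  have hSi := h.integrableOn_cross_self
  have iV := intervalIntegrable_of_Icc (integrableOn_clm_comp h.measurable_coeff h.bound hVi) ht
  have iW := intervalIntegrable_of_Icc (integrableOn_comp_adjoint h.measurable_coeff h.bound hWi) ht
  have iS := intervalIntegrable_of_Icc (integrableOn_clm_comp h.measurable_coeff h.bound hSi) ht
  have iS' := intervalIntegrable_of_Icc
    (integrableOn_comp_adjoint h.measurable_coeff h.bound hSi) ht
  have hG : ContinuousLinearMap.adjoint (G t) = G t := by
    rw [← h.noise.cross_eq t t ht.1 le_rfl ht.2,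
      adjoint_cross (h.noise.memLp t ht) (h.noise.memLp t ht)]
  -- Correlating with the fixed variable `N τ` instead of `N t` gives a closed equation for `V t =
  -- cross P (Δ t) (N τ)`; the next identity is its adjoint.
  have e1 : cross P (Δ t) (N τ) = (∫ s in t₀..t, L s ∘L cross P (Δ s) (N τ)) + G t := by
    rw [hVe t ht, h.noise.cross_init τ hτ, zero_add, h.noise.cross_eq t τ ht.1 ht.2 le_rfl]
  have e2 : cross P (N τ) (Δ t) = (∫ s in t₀..t, cross P (N τ) (Δ s) ∘L
      ContinuousLinearMap.adjoint (L s)) + G t := by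
    rw [← adjoint_cross (h.memLp t ht) hNτ, e1, map_add, hG, ← adjointL_apply,
      ← ContinuousLinearMap.intervalIntegral_comp_comm _ iV]
    congr 1
    refine intervalIntegral.integral_congr fun s hs => ?_
    rw [uIcc_of_le ht.1] at hs
    simp only [adjointL_apply, ContinuousLinearMap.adjoint_comp]
    rw [adjoint_cross (h.memLp s ⟨hs.1, hs.2.trans ht.2⟩) hNτ]
  have f1 : ∀ s ∈ Icc t₀ τ, cross P (Δ s) (fun ω => Δ s ω - N s ω) =
      cross P (Δ s) (Δ s) - cross P (Δ s) (N τ) := fun s hs => by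
    rw [cross_sub_right (h.memLp s hs) (h.memLp s hs) (h.noise.memLp s hs),
      h.cross_noise_eq h.nonneg hs]
  have f2 : ∀ s ∈ Icc t₀ τ, cross P (fun ω => Δ s ω - N s ω) (Δ s) =
      cross P (Δ s) (Δ s) - cross P (N τ) (Δ s) := fun s hs => by
    rw [← adjoint_cross (h.memLp s hs) (h.memLp_sub s hs), f1 s hs, map_sub,
      adjoint_cross (h.memLp s hs) (h.memLp s hs), adjoint_cross (h.memLp s hs) hNτ]
  have e4 : cross P (fun ω => Δ t ω - N t ω) (fun ω => Δ t ω - N t ω) =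
      cross P (Δ t) (Δ t) - cross P (N τ) (Δ t) - (cross P (Δ t) (N τ) - G t) := by
    rw [cross_sub_right (h.memLp_sub t ht) (h.memLp t ht) (h.noise.memLp t ht), f2 t ht,
      cross_sub_left (h.memLp t ht) (h.noise.memLp t ht) (h.noise.memLp t ht),
      h.cross_noise_eq h.nonneg ht, h.noise.cross_eq t t ht.1 le_rfl ht.2]
  have e3 := h.cross_sub_self ht
  have e5 : ∫ s in t₀..t, (L s ∘L cross P (Δ s) (fun ω => Δ s ω - N s ω) +
        cross P (fun ω => Δ s ω - N s ω) (Δ s) ∘L ContinuousLinearMap.adjoint (L s)) =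
      ∫ s in t₀..t, ((L s ∘L cross P (Δ s) (Δ s) +
        cross P (Δ s) (Δ s) ∘L ContinuousLinearMap.adjoint (L s)) -
        (L s ∘L cross P (Δ s) (N τ) + cross P (N τ) (Δ s) ∘L
          ContinuousLinearMap.adjoint (L s))) := by
    refine intervalIntegral.integral_congr fun s hs => ?_
    rw [uIcc_of_le ht.1] at hs
    have hs' : s ∈ Icc t₀ τ := ⟨hs.1, hs.2.trans ht.2⟩
    simp only [f1 s hs', f2 s hs', ContinuousLinearMap.comp_sub, ContinuousLinearMap.sub_comp]
    abel
  -- With `S` the second moment of `Δ`, the left side is `S - V* - V + G`, and the right side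
  -- contains `-(V - G) - (V* - G)` in place of the integrals of `L V` and `V* L*`. Hence `V` and
  -- `V*` drop out and `2 G - G = G` remains.
  rw [e5, intervalIntegral.integral_sub (iS.add iS') (iV.add iW),
    intervalIntegral.integral_add iV iW, e4, e1, e2] at e3
  rw [sub_eq_iff_eq_add, sub_eq_iff_eq_add] at e3
  rw [e3]
  abel

end IsLinearSystem

end System

/-! ### The Lyapunov equation -/

section Lyapunov

variable {H : Type*} [NormedAddCommGroup H] [InnerProductSpace ℝ H] [FiniteDimensional ℝ H]
  [MeasurableSpace H] [BorelSpace H] {L q : ℝ → H →L[ℝ] H} {t₀ τ c : ℝ} {S₀ : H →L[ℝ] H}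
  {T T' : ℝ → H →L[ℝ] H}

/-- The right-hand side `L S + S L* + q` of the Lyapunov equation. -/
noncomputable def lyapunovField (L q : ℝ → H →L[ℝ] H) (t : ℝ) (S : H →L[ℝ] H) : H →L[ℝ] H :=
  (L t ∘L S + S ∘L ContinuousLinearMap.adjoint (L t)) + q t

theorem integrableOn_lyapunovField (hL : Measurable L) (hc : ∀ t ∈ Icc t₀ τ, ‖L t‖ ≤ c)
    (hq : IntegrableOn q (Icc t₀ τ)) (hT : IntegrableOn T (Icc t₀ τ)) :
    IntegrableOn (fun t => lyapunovField L q t (T t)) (Icc t₀ τ) := by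
  unfold lyapunovField
  have h₁ : Integrable _ (volume.restrict (Icc t₀ τ)) := integrableOn_clm_comp hL hc hT
  have h₂ : Integrable _ (volume.restrict (Icc t₀ τ)) := integrableOn_comp_adjoint hL hc hT
  exact Integrable.add (ε' := H →L[ℝ] H) (Integrable.add (ε' := H →L[ℝ] H) h₁ h₂) hq

/-- Solutions of the Lyapunov equation in the sense of Carathéodory. -/
def SolvesLyapunov (t₀ τ : ℝ) (L q : ℝ → H →L[ℝ] H) (S₀ : H →L[ℝ] H) (T : ℝ → H →L[ℝ] H) :
    Prop :=
  ∀ t ∈ Icc t₀ τ, T t = S₀ + ∫ s in t₀..t, lyapunovField L q s (T s)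

theorem continuousWithinAt_adjoint {V W : Type*} [NormedAddCommGroup V] [InnerProductSpace ℝ V]
    [CompleteSpace V] [NormedAddCommGroup W] [InnerProductSpace ℝ W] [CompleteSpace W]
    {f : ℝ → V →L[ℝ] W} {s : Set ℝ} {t : ℝ} (hf : ContinuousWithinAt f s t) :
    ContinuousWithinAt (fun t => ContinuousLinearMap.adjoint (f t)) s t :=
  (LinearIsometryEquiv.continuous _).continuousAt.comp_continuousWithinAt hf

namespace SolvesLyapunov

variable (h : SolvesLyapunov t₀ τ L q S₀ T)
include h

theorem continuousOn (hL : Measurable L) (hc : ∀ t ∈ Icc t₀ τ, ‖L t‖ ≤ c)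
    (hq : IntegrableOn q (Icc t₀ τ)) (hT : IntegrableOn T (Icc t₀ τ)) :
    ContinuousOn T (Icc t₀ τ) := by
  rcases lt_or_ge τ t₀ with hlt | hle
  · simp [Icc_eq_empty (not_le.2 hlt)]
  refine ContinuousOn.congr (f := fun t => S₀ + ∫ s in t₀..t, lyapunovField L q s (T s)) ?_ h
  have hi := integrableOn_lyapunovField hL hc hq hT
  exact continuousOn_const.add
    (intervalIntegral.continuousOn_primitive_interval (by rwa [uIcc_of_le hle]) |>.mono
      (by rw [uIcc_of_le hle]))

theorem ae_hasDerivAt (hL : Measurable L) (hc : ∀ t ∈ Icc t₀ τ, ‖L t‖ ≤ c)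
    (hq : IntegrableOn q (Icc t₀ τ)) (hT : IntegrableOn T (Icc t₀ τ)) :
    ∀ᵐ t ∂(volume.restrict (Icc t₀ τ)), HasDerivAt T (lyapunovField L q t (T t)) t := by
  rcases lt_or_ge τ t₀ with hlt | hle
  · simp [Icc_eq_empty (not_le.2 hlt)]
  -- Discarding the two endpoints costs a null set, and at interior points the integral equation
  -- holds in a neighbourhood, as a two-sided derivative requires.
  rw [← restrict_Ioo_eq_restrict_Icc, ae_restrict_iff' measurableSet_Ioo]
  have hii : IntervalIntegrable (fun t => lyapunovField L q t (T t)) volume t₀ τ :=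
    intervalIntegrable_of_Icc (integrableOn_lyapunovField hL hc hq hT) ⟨hle, le_rfl⟩
  filter_upwards [hii.ae_hasDerivAt_integral] with t ht hmem
  have := (ht (by rw [uIcc_of_le hle]; exact Ioo_subset_Icc_self hmem) t₀ (by simp)).const_add S₀
  refine this.congr_of_eventuallyEq ?_
  filter_upwards [Icc_mem_nhds hmem.1 hmem.2] with s hs using h s hs

theorem hasDerivWithinAt (hL : Measurable L) (hc : ∀ t ∈ Icc t₀ τ, ‖L t‖ ≤ c)
    (hq : IntegrableOn q (Icc t₀ τ)) (hT : IntegrableOn T (Icc t₀ τ)) {t : ℝ}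
    (ht : t ∈ Icc t₀ τ) (hLt : ContinuousWithinAt L (Icc t₀ τ) t)
    (hqt : ContinuousWithinAt q (Icc t₀ τ) t) :
    HasDerivWithinAt T (lyapunovField L q t (T t)) (Icc t₀ τ) t := by
  have := Fact.mk ht
  have hTt := h.continuousOn hL hc hq hT t ht
  have hi := integrableOn_lyapunovField hL hc hq hT
  have hf : ContinuousWithinAt (fun t => lyapunovField L q t (T t)) (Icc t₀ τ) t :=
    ((hLt.clm_comp hTt).add (hTt.clm_comp (continuousWithinAt_adjoint hLt))).add hqt
  have := (intervalIntegral.integral_hasDerivWithinAt_right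
    (s := Icc t₀ τ) (t := Icc t₀ τ) (intervalIntegrable_of_Icc hi ht)
    ⟨_, self_mem_nhdsWithin, hi.aestronglyMeasurable⟩
    hf).const_add S₀
  exact this.congr_of_mem (fun s hs => h s hs) ht

theorem eqOn (h' : SolvesLyapunov t₀ τ L q S₀ T') (hL : Measurable L) (hc₀ : 0 ≤ c)
    (hc : ∀ t ∈ Icc t₀ τ, ‖L t‖ ≤ c) (hq : IntegrableOn q (Icc t₀ τ))
    (hT : IntegrableOn T (Icc t₀ τ)) (hT' : IntegrableOn T' (Icc t₀ τ)) :
    EqOn T T' (Icc t₀ τ) := by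
  intro t ht
  -- The factor 2 accounts for the two terms `L D` and `D L*`, where `D = T - T'`; the inhomogeneity
  -- `q` cancels.
  refine sub_eq_zero.1 (eq_zero_of_norm_le_mul_integral (c := 2 * c) (t₀ := t₀) (τ := τ)
    (u := fun s => T s - T' s) (by positivity) (hT.sub hT') (fun t ht => ?_) t ht)
  rw [h t ht, h' t ht, add_sub_add_left_eq_sub, ← intervalIntegral.integral_sub
    (intervalIntegrable_of_Icc (integrableOn_lyapunovField hL hc hq hT) ht)
    (intervalIntegrable_of_Icc (integrableOn_lyapunovField hL hc hq hT') ht),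
    ← intervalIntegral.integral_const_mul]
  refine intervalIntegral.norm_integral_le_of_norm_le ht.1 (ae_of_all _ fun s hs => ?_)
    ((intervalIntegrable_of_Icc (hT.sub hT') ht).norm.const_mul (2 * c))
  have hs' : s ∈ Icc t₀ τ := ⟨hs.1.le, hs.2.trans ht.2⟩
  have e : lyapunovField L q s (T s) - lyapunovField L q s (T' s) =
      L s ∘L (T s - T' s) + (T s - T' s) ∘L ContinuousLinearMap.adjoint (L s) := by
    rw [ContinuousLinearMap.comp_sub, ContinuousLinearMap.sub_comp, lyapunovField, lyapunovField]
    abel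
  rw [e]
  refine (norm_add_le _ _).trans ?_
  have h1 := (L s).opNorm_comp_le (T s - T' s)
  have h2 := (T s - T' s).opNorm_comp_le (ContinuousLinearMap.adjoint (L s))
  rw [LinearIsometryEquiv.norm_map] at h2
  have h3 := mul_le_mul_of_nonneg_right (hc s hs') (norm_nonneg (T s - T' s))
  rw [mul_comm (‖T s - T' s‖)] at h2
  linarith

end SolvesLyapunov

/-- For a rank-one operator, `tr (M* (x ⊗ x)) = ⟪x, M x⟫`; the trace pairing with `M` is a
continuous linear functional and commutes with the expectation. -/
theorem integral_inner_apply_eq_opInner {Ω : Type*} [MeasurableSpace Ω] {P : Measure Ω}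
    (M : H →L[ℝ] H) {X : Ω → H} (h : MemLp X 2 P) :
    ∫ ω, ⟪X ω, M (X ω)⟫_ℝ ∂P = opInner M (secondMoment P X) := by
  let ℓ : (H →L[ℝ] H) →L[ℝ] ℝ := LinearMap.toContinuousLinearMap
    { toFun := fun T => opInner M T
      map_add' := fun S T => by simp [opInner]
      map_smul' := fun r T => by simp [opInner] }
  have hℓ : ∀ T, ℓ T = opInner M T := fun T => rfl
  rw [secondMoment_eq_cross, cross, ← hℓ, ← ℓ.integral_comp_comm (integrable_outer h h)]
  refine integral_congr_ae (ae_of_all _ fun ω => ?_)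
  simp only [hℓ, opInner]
  rw [comp_outer, outer_eq_rankOne, InnerProductSpace.trace_rankOne,
    ContinuousLinearMap.adjoint_inner_right, real_inner_comm]

end Lyapunov

/-! ### Measurability and bounds for the drift and the noise intensity -/

section Coefficients

variable {E H : Type*} [NormedAddCommGroup E] [InnerProductSpace ℝ E] [FiniteDimensional ℝ E]
  [MeasurableSpace E] [BorelSpace E] [NormedAddCommGroup H] [InnerProductSpace ℝ H]
  [FiniteDimensional ℝ H] [MeasurableSpace H] [BorelSpace H]

theorem MeasLocBdd.const (T : E →L[ℝ] H) : MeasLocBdd fun _ : ℝ => T :=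
  ⟨measurable_const, fun _ _ => ⟨‖T‖, fun _ _ => le_rfl⟩⟩

/-- The drift `A - K C`. -/
noncomputable def gainDrift (C : H →L[ℝ] E) (A : ℝ → H →L[ℝ] H) (K : ℝ → E →L[ℝ] H) (t : ℝ) :
    H →L[ℝ] H := A t - K t ∘L C

/-- The intensity `B Q B* + K R K*`. -/
noncomputable def noiseIntensity (B : E →L[ℝ] H) (Q R : ℝ → E →L[ℝ] E) (K : ℝ → E →L[ℝ] H)
    (t : ℝ) : H →L[ℝ] H :=
  B ∘L Q t ∘L ContinuousLinearMap.adjoint B + K t ∘L R t ∘L ContinuousLinearMap.adjoint (K t)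

variable {B : E →L[ℝ] H} {C : H →L[ℝ] E} {A : ℝ → H →L[ℝ] H} {Q R S : ℝ → E →L[ℝ] E}
  {K : ℝ → E →L[ℝ] H}

theorem measurable_gainDrift (hA : Continuous A) (hK : MeasLocBdd K) :
    Measurable (gainDrift C A K) := by
  have h : Continuous fun T : E →L[ℝ] H => T ∘L C := by fun_prop
  exact hA.measurable.sub (h.measurable.comp hK.1)

theorem exists_bound_gainDrift (hA : Continuous A) (hK : MeasLocBdd K) (t₀ τ : ℝ) :
    ∃ c, 0 ≤ c ∧ ∀ t ∈ Icc t₀ τ, ‖gainDrift C A K t‖ ≤ c := by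
  obtain ⟨a, ha⟩ := isCompact_Icc.exists_bound_of_continuousOn (hA.continuousOn (s := Icc t₀ τ))
  obtain ⟨k, hk⟩ := hK.2 t₀ τ
  refine ⟨|a| + |k| * ‖C‖, by positivity, fun t ht => ?_⟩
  refine (norm_sub_le _ _).trans (add_le_add ((ha t ht).trans (le_abs_self _)) ?_)
  exact ((K t).opNorm_comp_le _).trans
    (mul_le_mul_of_nonneg_right ((hk t ht).trans (le_abs_self _)) (norm_nonneg _))

/-- This form covers `K R K*` as well as `B Q B*`, the latter with a constant gain. -/
theorem measurable_sandwich (hK : Measurable K) (hS : Measurable S) :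
    Measurable fun t => K t ∘L S t ∘L ContinuousLinearMap.adjoint (K t) := by
  have h : Continuous fun p : (E →L[ℝ] H) × (E →L[ℝ] E) =>
      p.1 ∘L p.2 ∘L ContinuousLinearMap.adjoint p.1 :=
    continuous_fst.clm_comp (continuous_snd.clm_comp
      ((LinearIsometryEquiv.continuous _).comp continuous_fst))
  exact h.measurable.comp (hK.prodMk hS)

theorem exists_bound_sandwich (hK : MeasLocBdd K) (hS : MeasLocBdd S) (t₀ τ : ℝ) :
    ∃ c, ∀ t ∈ Icc t₀ τ, ‖K t ∘L S t ∘L ContinuousLinearMap.adjoint (K t)‖ ≤ c := by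
  obtain ⟨k, hk⟩ := hK.2 t₀ τ
  obtain ⟨s, hs⟩ := hS.2 t₀ τ
  refine ⟨k * (s * k), fun t ht => ?_⟩
  have hk₀ := (norm_nonneg _).trans (hk t ht)
  have hs₀ := (norm_nonneg _).trans (hs t ht)
  refine ((K t).opNorm_comp_le _).trans (mul_le_mul (hk t ht) ?_ (norm_nonneg _) hk₀)
  refine ((S t).opNorm_comp_le _).trans (mul_le_mul (hs t ht) ?_ (norm_nonneg _) hs₀)
  rw [LinearIsometryEquiv.norm_map]
  exact hk t ht

theorem integrableOn_sandwich (hK : MeasLocBdd K) (hS : MeasLocBdd S) (t₀ τ : ℝ) :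
    IntegrableOn (fun t => K t ∘L S t ∘L ContinuousLinearMap.adjoint (K t)) (Icc t₀ τ) := by
  obtain ⟨c, hc⟩ := exists_bound_sandwich hK hS t₀ τ
  refine Measure.integrableOn_of_bounded (M := c) (by simp)
    (measurable_sandwich hK.1 hS.1).aestronglyMeasurable ?_
  filter_upwards [ae_restrict_mem measurableSet_Icc] with t ht using hc t ht

theorem integrableOn_noiseIntensity (hK : MeasLocBdd K) (hQ : MeasLocBdd Q) (hR : MeasLocBdd R)
    (t₀ τ : ℝ) : IntegrableOn (noiseIntensity B Q R K) (Icc t₀ τ) := by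
  change IntegrableOn (fun t => noiseIntensity B Q R K t) (Icc t₀ τ)
  unfold noiseIntensity
  have h₁ : Integrable _ (volume.restrict (Icc t₀ τ)) := integrableOn_sandwich (.const B) hQ t₀ τ
  have h₂ : Integrable _ (volume.restrict (Icc t₀ τ)) := integrableOn_sandwich hK hR t₀ τ
  exact Integrable.add (ε' := H →L[ℝ] H) h₁ h₂

theorem exists_bound_noiseIntensity (hK : MeasLocBdd K) (hQ : MeasLocBdd Q) (hR : MeasLocBdd R)
    (t₀ τ : ℝ) : ∃ c, 0 ≤ c ∧ ∀ t ∈ Icc t₀ τ, ‖noiseIntensity B Q R K t‖ ≤ c := by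
  obtain ⟨a, ha⟩ := exists_bound_sandwich (.const B) hQ t₀ τ
  obtain ⟨b, hb⟩ := exists_bound_sandwich hK hR t₀ τ
  exact ⟨|a| + |b|, by positivity, fun t ht => (norm_add_le _ _).trans
    (add_le_add ((ha t ht).trans (le_abs_self _)) ((hb t ht).trans (le_abs_self _)))⟩

theorem continuousWithinAt_gainDrift (hA : Continuous A) {s : Set ℝ} {t : ℝ}
    (hK : ContinuousWithinAt K s t) : ContinuousWithinAt (gainDrift C A K) s t :=
  hA.continuousWithinAt.sub (hK.clm_comp continuousWithinAt_const)

theorem continuousWithinAt_noiseIntensity {s : Set ℝ} {t : ℝ}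
    (hK : ContinuousWithinAt K s t) (hQ : ContinuousWithinAt Q s t)
    (hR : ContinuousWithinAt R s t) : ContinuousWithinAt (noiseIntensity B Q R K) s t :=
  (continuousWithinAt_const.clm_comp (hQ.clm_comp continuousWithinAt_const)).add
    (hK.clm_comp (hR.clm_comp (continuousWithinAt_adjoint hK)))

end Coefficients

section Specialization

variable {E : Type*} [NormedAddCommGroup E] [InnerProductSpace ℝ E] [FiniteDimensional ℝ E]
  [MeasurableSpace E] [BorelSpace E] {A : ℝ → Sq E →L[ℝ] Sq E} {Q R : ℝ → E →L[ℝ] E}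
  {K : ℝ → E →L[ℝ] Sq E} {t₀ τ : ℝ} {S₀ : Sq E →L[ℝ] Sq E} {T : ℝ → Sq E →L[ℝ] Sq E}

theorem covField_eq (t : ℝ) (S : Sq E →L[ℝ] Sq E) : covField A Q R K t S =
    lyapunovField (gainDrift opC A K) (noiseIntensity opB Q R K) t S := by
  simp only [covField, lyapunovField, gainDrift, noiseIntensity, add_assoc]

end Specialization

/-! ### Joint measurability of processes with Lipschitz mean square increments -/

section Modification

variable {Ω : Type*} [MeasurableSpace Ω] {P : Measure Ω} {t₀ τ C : ℝ}

/-- The largest point of the grid of mesh `2⁻ᵏ` below `t`, but at least `t₀`. -/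
noncomputable def gridPoint (t₀ : ℝ) (k : ℕ) (t : ℝ) : ℝ := max t₀ (⌊2 ^ k * t⌋ / 2 ^ k)

theorem gridPoint_mem {t : ℝ} (ht : t₀ ≤ t) (k : ℕ) :
    t₀ ≤ gridPoint t₀ k t ∧ gridPoint t₀ k t ≤ t ∧ t - gridPoint t₀ k t ≤ (1 / 2) ^ k := by
  have h2 : (0 : ℝ) < 2 ^ k := by positivity
  refine ⟨le_max_left _ _, max_le ht ?_, ?_⟩
  · rw [div_le_iff₀ h2, mul_comm]
    exact Int.floor_le _
  · have h1 : (⌊2 ^ k * t⌋ : ℝ) / 2 ^ k ≤ gridPoint t₀ k t := le_max_right _ _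
    have h3 : t - (1 / 2) ^ k ≤ (⌊2 ^ k * t⌋ : ℝ) / 2 ^ k := by
      rw [le_div_iff₀ h2, sub_mul, ← mul_pow]
      norm_num
      linarith [(Int.sub_one_lt_floor (2 ^ k * t)).le]
    linarith

/-- The grid point depends on `t` only through the integer `⌊2 ^ k * t⌋`, so joint measurability
reduces to countably many measurable variables. -/
theorem measurable_comp_gridPoint {Y : ℝ → Ω → ℝ} (hY : ∀ t, Measurable (Y t)) (k : ℕ) :
    Measurable fun p : ℝ × Ω => Y (gridPoint t₀ k p.1) p.2 := by
  have h : Measurable fun q : ℤ × Ω => Y (max t₀ (q.1 / 2 ^ k)) q.2 :=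
    measurable_from_prod_countable_right fun m => hY (max t₀ (m / 2 ^ k))
  exact h.comp (((measurable_const.mul measurable_fst).floor).prodMk measurable_snd)

/-- A process with Lipschitz mean square increments has a jointly measurable modification. -/
theorem exists_measurable_modification {Y : ℝ → Ω → ℝ} (hY : ∀ t, Measurable (Y t))
    (hinc : ∀ s t, t₀ ≤ s → s ≤ t → t ≤ τ →
      ∫⁻ ω, ENNReal.ofReal ((Y t ω - Y s ω) ^ 2) ∂P ≤ ENNReal.ofReal (C * (t - s)))
    (hC : 0 ≤ C) :
    ∃ Z : ℝ → Ω → ℝ, Measurable (fun p : ℝ × Ω => Z p.1 p.2) ∧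
      ∀ t ∈ Icc t₀ τ, Z t =ᵐ[P] Y t := by
  -- The upper limit is jointly measurable whether or not the sequence converges.
  refine ⟨fun t ω => Filter.limsup (fun k => Y (gridPoint t₀ k t) ω) Filter.atTop,
    Measurable.limsup fun k => measurable_comp_gridPoint hY k, fun t ht => ?_⟩
  have hm : ∀ k, Measurable fun ω => ENNReal.ofReal ((Y t ω - Y (gridPoint t₀ k t) ω) ^ 2) :=
    fun k => (((hY t).sub (hY _)).pow_const 2).ennreal_ofReal
  have hgeo : Summable fun k : ℕ => C * (1 / 2 : ℝ) ^ k := summable_geometric_two.mul_left C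
  -- The mean squares are at most `C 2⁻ᵏ`. Being summable, they make the series of squared
  -- differences finite almost surely, so its terms tend to zero and the approximations converge to
  -- `Y t`.
  have hfin : ∫⁻ ω, ∑' k, ENNReal.ofReal ((Y t ω - Y (gridPoint t₀ k t) ω) ^ 2) ∂P ≠ ⊤ := by
    rw [lintegral_tsum fun k => (hm k).aemeasurable]
    refine ne_top_of_le_ne_top ?_ (ENNReal.tsum_le_tsum (g := fun k : ℕ =>
      ENNReal.ofReal (C * (1 / 2 : ℝ) ^ k)) fun k => ?_)
    · rw [← ENNReal.ofReal_tsum_of_nonneg (fun k => by positivity) hgeo]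
      exact ENNReal.ofReal_ne_top
    · obtain ⟨h1, h2, h3⟩ := gridPoint_mem ht.1 k
      exact (hinc _ _ h1 h2 ht.2).trans
        (ENNReal.ofReal_le_ofReal (mul_le_mul_of_nonneg_left h3 hC))
  filter_upwards [ae_lt_top (Measurable.tsum hm) hfin] with ω hω
  have h0 := ENNReal.tendsto_atTop_zero_of_tsum_ne_top hω.ne
  refine Filter.Tendsto.limsup_eq ?_
  have h1 : Filter.Tendsto (fun k => (Y t ω - Y (gridPoint t₀ k t) ω) ^ 2) Filter.atTop
      (nhds 0) := by
    have := (ENNReal.tendsto_toReal ENNReal.zero_ne_top).comp h0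
    simpa [Function.comp_def, ENNReal.toReal_ofReal (sq_nonneg _)] using this
  have h2 : Filter.Tendsto (fun k => Y t ω - Y (gridPoint t₀ k t) ω) Filter.atTop (nhds 0) := by
    rw [tendsto_zero_iff_abs_tendsto_zero]
    simpa [Function.comp_def, Real.sqrt_sq_eq_abs] using h1.sqrt
  simpa using h2.const_sub (Y t ω)

end Modification

/-! ### White noise integrals -/

section WhiteNoise

variable {E H : Type*} [NormedAddCommGroup E] [InnerProductSpace ℝ E] [FiniteDimensional ℝ E]
  [MeasurableSpace E] [BorelSpace E] [NormedAddCommGroup H] [InnerProductSpace ℝ H]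
  [FiniteDimensional ℝ H] [MeasurableSpace H] [BorelSpace H]
  {Ω : Type*} [MeasurableSpace Ω] {P : Measure Ω} [IsProbabilityMeasure P]
  {S Q R : ℝ → E →L[ℝ] E} {v w : (ℝ → E) → Ω → ℝ} {B : E →L[ℝ] H} {K Γ : ℝ → E →L[ℝ] H}
  {t₀ τ : ℝ} {X₀ : Ω → H} {φ ψ : ℝ → E}

/-- The test function `1_{(t₀, t]} Γ* ζ`. -/
noncomputable def gainTest (Γ : ℝ → E →L[ℝ] H) (t₀ t : ℝ) (ζ : H) : ℝ → E :=
  (Ioc t₀ t).indicator fun s => ContinuousLinearMap.adjoint (Γ s) ζ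

theorem isTestFun_gainTest (hΓ : MeasLocBdd Γ) (t₀ t : ℝ) (ζ : H) :
    IsTestFun (gainTest Γ t₀ t ζ) := by
  refine ⟨?_, ?_, ?_⟩
  · refine Measurable.indicator ?_ measurableSet_Ioc
    have h : Continuous fun T : E →L[ℝ] H => ContinuousLinearMap.adjoint T ζ :=
      (ContinuousLinearMap.apply ℝ E ζ).continuous.comp
        (LinearIsometryEquiv.continuous (ContinuousLinearMap.adjoint (𝕜 := ℝ) (E := E) (F := H)))
    exact h.measurable.comp hΓ.1
  · obtain ⟨c, hc⟩ := hΓ.2 t₀ t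
    refine ⟨|c| * ‖ζ‖, fun s => ?_⟩
    by_cases hs : s ∈ Ioc t₀ t
    · rw [gainTest, indicator_of_mem hs]
      refine (ContinuousLinearMap.le_opNorm _ _).trans
        (mul_le_mul_of_nonneg_right ?_ (norm_nonneg _))
      rw [LinearIsometryEquiv.norm_map]
      exact (hc s (Ioc_subset_Icc_self hs)).trans (le_abs_self _)
    · rw [gainTest, indicator_of_notMem hs, norm_zero]
      positivity
  · exact HasCompactSupport.intro (isCompact_Icc (a := t₀) (b := t)) fun s hs =>
      indicator_of_notMem (fun h => hs (Ioc_subset_Icc_self h)) _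

theorem IsTestFun.integrable_inner (hS : MeasLocBdd S) (hφ : IsTestFun φ) (hψ : IsTestFun ψ) :
    Integrable fun t => ⟪φ t, S t (ψ t)⟫_ℝ := by
  obtain ⟨hφm, ⟨a, ha⟩, hφc⟩ := hφ
  obtain ⟨hψm, ⟨b, hb⟩, -⟩ := hψ
  obtain ⟨r, hr⟩ := hφc.isCompact.isBounded.subset_closedBall 0
  rw [Real.closedBall_eq_Icc] at hr
  obtain ⟨c, hc⟩ := hS.2 (0 - r) (0 + r)
  have hm : Measurable fun t => ⟪φ t, S t (ψ t)⟫_ℝ :=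
    hφm.inner (measurable_clm_apply hS.1 hψm)
  rw [← integrableOn_iff_integrable_of_support_subset (s := Icc (0 - r) (0 + r))]
  · refine Measure.integrableOn_of_bounded (M := a * (c * b)) (by simp) hm.aestronglyMeasurable ?_
    filter_upwards [ae_restrict_mem measurableSet_Icc] with t ht
    have ha₀ := (norm_nonneg _).trans (ha t)
    have hc₀ := (norm_nonneg (S t)).trans (hc t ht)
    refine (norm_inner_le_norm _ _).trans (mul_le_mul (ha t) ?_ (norm_nonneg _) ha₀)
    exact ((S t).le_opNorm _).trans (mul_le_mul (hc t ht) (hb t) (norm_nonneg _) hc₀)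
  · intro t ht
    refine hr (subset_tsupport _ fun h => ht ?_)
    simp [h]

namespace IsWhiteNoise

variable (hv : IsWhiteNoise P S v)
include hv

theorem memLp (hφ : IsTestFun φ) : MemLp (v φ) 2 P :=
  (hv.gaussian.hasGaussianLaw_eval ⟨φ, hφ⟩).memLp_two

/-- Linearity of `v` in the test function is not part of the definition of white noise, but the
covariance forces it almost surely: by bilinearity the defect `u` is orthogonal to every `v ψ`,
hence to itself, and `E u² = 0`. -/
theorem ae_eq_sum (hS : MeasLocBdd S) {ι : Type*} (s : Finset ι) (a : ι → ℝ) {φs : ι → ℝ → E}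
    (hφ : IsTestFun φ) (hφs : ∀ i, IsTestFun (φs i)) (h : ∀ t, φ t = ∑ i ∈ s, a i • φs i t) :
    v φ =ᵐ[P] fun ω => ∑ i ∈ s, a i * v (φs i) ω := by
  set u : Ω → ℝ := fun ω => v φ ω - ∑ i ∈ s, a i * v (φs i) ω with hu
  have hsum : MemLp (fun ω => ∑ i ∈ s, a i * v (φs i) ω) 2 P :=
    memLp_finsetSum _ fun i _ => (hv.memLp (hφs i)).const_mul (a i)
  have hu2 : MemLp u 2 P := (hv.memLp hφ).sub hsum
  have horth : ∀ ψ, IsTestFun ψ → ∫ ω, u ω * v ψ ω ∂P = 0 := by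
    intro ψ hψ
    have hi : ∀ i, Integrable (fun ω => v (φs i) ω * v ψ ω) P := fun i =>
      (hv.memLp (hφs i)).integrable_mul (hv.memLp hψ)
    have e : ∀ ω, u ω * v ψ ω = v φ ω * v ψ ω - ∑ i ∈ s, a i * (v (φs i) ω * v ψ ω) := fun ω => by
      simp only [hu, sub_mul, Finset.sum_mul, mul_assoc]
    have hi' : Integrable (fun ω => v φ ω * v ψ ω) P :=
      (hv.memLp hφ).integrable_mul (hv.memLp hψ)
    simp_rw [e]
    rw [integral_sub hi'
      (integrable_finsetSum _ fun i _ => (hi i).const_mul (a i)),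
      integral_finsetSum _ fun i _ => (hi i).const_mul (a i), hv.covariance φ ψ hφ hψ]
    simp_rw [integral_const_mul, fun i => hv.covariance (φs i) ψ (hφs i) hψ, h, sum_inner,
      real_inner_smul_left]
    rw [integral_finsetSum _ fun i _ => ((hφs i).integrable_inner hS hψ).const_mul (a i)]
    simp_rw [integral_const_mul, sub_self]
  have h0 : ∫ ω, u ω ^ 2 ∂P = 0 := by
    have e : ∀ ω, u ω ^ 2 = u ω * v φ ω - ∑ i ∈ s, a i * (u ω * v (φs i) ω) := fun ω => by
      rw [sq]
      nth_rw 2 [hu]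
      simp only [mul_sub, Finset.mul_sum]
      congr 1
      exact Finset.sum_congr rfl fun i _ => by ring
    have hi : ∀ i, Integrable (fun ω => u ω * v (φs i) ω) P := fun i =>
      hu2.integrable_mul (hv.memLp (hφs i))
    have hi' : Integrable (fun ω => u ω * v φ ω) P := hu2.integrable_mul (hv.memLp hφ)
    simp_rw [e]
    rw [integral_sub hi'
      (integrable_finsetSum _ fun i _ => (hi i).const_mul (a i)),
      integral_finsetSum _ fun i _ => (hi i).const_mul (a i), horth φ hφ]
    simp_rw [integral_const_mul, fun i => horth (φs i) (hφs i)]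
    simp
  filter_upwards [(integral_eq_zero_iff_of_nonneg (fun ω => sq_nonneg (u ω))
    hu2.integrable_sq).1 h0]
    with ω hω
  exact sub_eq_zero.1 (pow_eq_zero_iff two_ne_zero |>.1 hω)

/-- The supports `(t₀, s]` and `(t₀, t]` overlap in `(t₀, s]` only, so the later time does not
enter: the increments are orthogonal. -/
theorem covariance_gainTest (hS : MeasLocBdd S) (hΓ : MeasLocBdd Γ) {s t : ℝ} (hs : t₀ ≤ s)
    (hst : s ≤ t) (ζ ξ : H) :
    ∫ ω, v (gainTest Γ t₀ s ζ) ω * v (gainTest Γ t₀ t ξ) ω ∂P =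
      ⟪ζ, (∫ r in t₀..s, Γ r ∘L S r ∘L ContinuousLinearMap.adjoint (Γ r)) ξ⟫_ℝ := by
  rw [hv.covariance _ _ (isTestFun_gainTest hΓ t₀ s ζ) (isTestFun_gainTest hΓ t₀ t ξ),
    ← matrixCoeff_apply, ← ContinuousLinearMap.intervalIntegral_comp_comm _
      (intervalIntegrable_of_Icc (integrableOn_sandwich hΓ hS t₀ s) ⟨hs, le_rfl⟩),
    intervalIntegral.integral_of_le hs, ← integral_indicator measurableSet_Ioc]
  refine integral_congr_ae (ae_of_all _ fun r => ?_)
  by_cases hr : r ∈ Ioc t₀ s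
  · have hr' : r ∈ Ioc t₀ t := ⟨hr.1, hr.2.trans hst⟩
    simp only [gainTest, indicator_of_mem hr, indicator_of_mem hr', matrixCoeff_apply,
      ContinuousLinearMap.comp_apply, ContinuousLinearMap.adjoint_inner_left]
  · simp only [gainTest, indicator_of_notMem hr, inner_zero_left]

end IsWhiteNoise

/-- The integral over `(t₀, t]` of the driving noise `K v - B w`, paired with `ζ`. -/
noncomputable def drivingNoise (B : E →L[ℝ] H) (K : ℝ → E →L[ℝ] H) (v w : (ℝ → E) → Ω → ℝ)
    (t₀ t : ℝ) (ζ : H) (ω : Ω) : ℝ :=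
  v (gainTest K t₀ t ζ) ω - w (gainTest (fun _ => B) t₀ t ζ) ω

theorem indepFun_of_indep_noiseSigma {α : Type*} [MeasurableSpace α] {m : MeasurableSpace Ω}
    {X : Ω → α} (h : Indep (noiseSigma v) m P) (hX : Measurable[m] X) (hφ : IsTestFun φ) :
    IndepFun (v φ) X P := by
  rw [IndepFun_iff_Indep]
  refine indep_of_indep_of_le_left (indep_of_indep_of_le_right h hX.comap_le) ?_
  refine Measurable.comap_le ?_
  have h1 : Measurable[noiseSigma v] fun ω (φ : {φ : ℝ → E // IsTestFun φ}) => v φ ω :=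
    comap_measurable _
  exact (measurable_pi_apply (⟨φ, hφ⟩ : {φ : ℝ → E // IsTestFun φ})).comp h1

theorem measurable_noiseSigma (hφ : IsTestFun φ) : Measurable[noiseSigma v] (v φ) := by
  have h1 : Measurable[noiseSigma v] fun ω (φ : {φ : ℝ → E // IsTestFun φ}) => v φ ω :=
    comap_measurable _
  exact (measurable_pi_apply (⟨φ, hφ⟩ : {φ : ℝ → E // IsTestFun φ})).comp h1

namespace NoiseAssumption

variable (hn : NoiseAssumption P Q R v w X₀)
include hn

theorem integral_mul_eq_zero (hφ : IsTestFun φ) (hψ : IsTestFun ψ) :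
    ∫ ω, v φ ω * w ψ ω ∂P = 0 := by
  have h := indepFun_of_indep_noiseSigma (hn.indep.indep (i := 0) (j := 1) (by decide))
    (measurable_noiseSigma (v := w) hψ) hφ
  have := h.integral_mul_eq_mul_integral (hn.white_v.memLp hφ).aestronglyMeasurable
    (hn.white_w.memLp hψ).aestronglyMeasurable
  simpa [hn.white_v.mean_zero φ hφ] using this

theorem integral_v_mul_init (hφ : IsTestFun φ) (a : H) :
    ∫ ω, ⟪a, X₀ ω⟫_ℝ * v φ ω ∂P = 0 := by
  have hX : Measurable[MeasurableSpace.comap X₀ inferInstance] fun ω => ⟪a, X₀ ω⟫_ℝ :=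
    (measurable_const.inner measurable_id).comp (comap_measurable X₀)
  have h := indepFun_of_indep_noiseSigma (hn.indep.indep (i := 0) (j := 2) (by decide)) hX hφ
  have := h.integral_mul_eq_mul_integral (hn.white_v.memLp hφ).aestronglyMeasurable
    (measurable_const.inner hn.measurable_init).aestronglyMeasurable
  simp_rw [mul_comm _ (v φ _)]
  simpa [hn.white_v.mean_zero φ hφ] using this

theorem integral_w_mul_init (hφ : IsTestFun φ) (a : H) :
    ∫ ω, ⟪a, X₀ ω⟫_ℝ * w φ ω ∂P = 0 := by
  have hX : Measurable[MeasurableSpace.comap X₀ inferInstance] fun ω => ⟪a, X₀ ω⟫_ℝ :=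
    (measurable_const.inner measurable_id).comp (comap_measurable X₀)
  have h := indepFun_of_indep_noiseSigma (hn.indep.indep (i := 1) (j := 2) (by decide)) hX hφ
  have := h.integral_mul_eq_mul_integral (hn.white_w.memLp hφ).aestronglyMeasurable
    (measurable_const.inner hn.measurable_init).aestronglyMeasurable
  simp_rw [mul_comm _ (w φ _)]
  simpa [hn.white_w.mean_zero φ hφ] using this

theorem memLp_drivingNoise (hK : MeasLocBdd K) (t : ℝ) (ζ : H) :
    MemLp (drivingNoise B K v w t₀ t ζ) 2 P :=
  (hn.white_v.memLp (isTestFun_gainTest hK t₀ t ζ)).sub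
    (hn.white_w.memLp (isTestFun_gainTest (.const B) t₀ t ζ))

theorem measurable_drivingNoise (hK : MeasLocBdd K) (t : ℝ) (ζ : H) :
    Measurable (drivingNoise B K v w t₀ t ζ) :=
  (hn.white_v.measurable _ (isTestFun_gainTest hK t₀ t ζ)).sub
    (hn.white_w.measurable _ (isTestFun_gainTest (.const B) t₀ t ζ))

theorem integral_init_mul_drivingNoise (hX₀ : MemLp X₀ 2 P) (hK : MeasLocBdd K) (t : ℝ)
    (a ζ : H) : ∫ ω, ⟪a, X₀ ω⟫_ℝ * drivingNoise B K v w t₀ t ζ ω ∂P = 0 := by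
  have h1 := isTestFun_gainTest hK t₀ t ζ
  have h2 := isTestFun_gainTest (.const B) t₀ t ζ
  have hX := hX₀.const_inner (𝕜 := ℝ) a
  have i1 : Integrable (fun ω => ⟪a, X₀ ω⟫_ℝ * v (gainTest K t₀ t ζ) ω) P :=
    hX.integrable_mul (hn.white_v.memLp h1)
  have i2 : Integrable (fun ω => ⟪a, X₀ ω⟫_ℝ * w (gainTest (fun _ => B) t₀ t ζ) ω) P :=
    hX.integrable_mul (hn.white_w.memLp h2)
  simp only [drivingNoise, mul_sub]
  rw [integral_sub i1 i2, hn.integral_v_mul_init h1, hn.integral_w_mul_init h2, sub_zero]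

theorem integral_drivingNoise_mul (hQ : MeasLocBdd Q) (hR : MeasLocBdd R) (hK : MeasLocBdd K)
    {s t : ℝ} (hs : t₀ ≤ s) (hst : s ≤ t) (ζ ξ : H) :
    ∫ ω, drivingNoise B K v w t₀ s ζ ω * drivingNoise B K v w t₀ t ξ ω ∂P =
      ⟪ζ, (∫ r in t₀..s, noiseIntensity B Q R K r) ξ⟫_ℝ := by
  have k1 := isTestFun_gainTest hK t₀ s ζ
  have k2 := isTestFun_gainTest hK t₀ t ξ
  have b1 := isTestFun_gainTest (.const B) t₀ s ζ
  have b2 := isTestFun_gainTest (.const B) t₀ t ξ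
  have mk1 := hn.white_v.memLp k1
  have mk2 := hn.white_v.memLp k2
  have mb1 := hn.white_w.memLp b1
  have mb2 := hn.white_w.memLp b2
  have i1 := mk1.integrable_mul mk2
  have i2 := mk1.integrable_mul mb2
  have i3 := mk2.integrable_mul mb1
  have i4 := mb1.integrable_mul mb2
  have e : (fun ω => drivingNoise B K v w t₀ s ζ ω * drivingNoise B K v w t₀ t ξ ω) =
      (v (gainTest K t₀ s ζ) * v (gainTest K t₀ t ξ) -
        v (gainTest K t₀ s ζ) * w (gainTest (fun _ => B) t₀ t ξ)) -
      (v (gainTest K t₀ t ξ) * w (gainTest (fun _ => B) t₀ s ζ) -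
        w (gainTest (fun _ => B) t₀ s ζ) * w (gainTest (fun _ => B) t₀ t ξ)) := by
    funext ω
    simp only [drivingNoise, Pi.mul_apply, Pi.sub_apply]
    ring
  have z1 := hn.integral_mul_eq_zero k1 b2
  have z2 := hn.integral_mul_eq_zero k2 b1
  have c1 := hn.white_v.covariance_gainTest hR hK hs hst ζ ξ
  have c2 := hn.white_w.covariance_gainTest hQ (.const B) hs hst ζ ξ
  have hint : ∫ r in t₀..s, noiseIntensity B Q R K r =
      (∫ r in t₀..s, B ∘L Q r ∘L ContinuousLinearMap.adjoint B) +
        ∫ r in t₀..s, K r ∘L R r ∘L ContinuousLinearMap.adjoint (K r) :=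
    intervalIntegral.integral_add
      (intervalIntegrable_of_Icc (integrableOn_sandwich (.const B) hQ t₀ s) ⟨hs, le_rfl⟩)
      (intervalIntegrable_of_Icc (integrableOn_sandwich hK hR t₀ s) ⟨hs, le_rfl⟩)
  rw [e, integral_sub' (i1.sub i2) (i3.sub i4), integral_sub' i1 i2, integral_sub' i3 i4, hint,
    add_apply, inner_add_right]
  simp only [Pi.mul_apply]
  rw [z1, z2, c1, c2]
  ring

/-- The pairings `⟪ζ, N t⟫` are known only up to a null set depending on `ζ` and `t`. This suffices,
since each matrix coefficient of a correlation operator involves at most two of them. -/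
theorem isAdditiveNoise (hX₀ : MemLp X₀ 2 P) (hQ : MeasLocBdd Q) (hR : MeasLocBdd R)
    (hK : MeasLocBdd K) {N : ℝ → Ω → H} (hN : Measurable fun p : ℝ × Ω => N p.1 p.2)
    (hNe : ∀ t ∈ Icc t₀ τ, ∀ ζ, (fun ω => ⟪ζ, N t ω⟫_ℝ) =ᵐ[P] drivingNoise B K v w t₀ t ζ) :
    IsAdditiveNoise P t₀ τ (fun t => ∫ s in t₀..t, noiseIntensity B Q R K s) X₀ N := by
  have hm : ∀ t ∈ Icc t₀ τ, MemLp (N t) 2 P := fun t ht => by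
    have h := memLp_finsetSum Finset.univ (p := 2) (μ := P)
      (f := fun i ω => ⟪stdOrthonormalBasis ℝ H i, N t ω⟫_ℝ • stdOrthonormalBasis ℝ H i)
      fun i _ => (ContinuousLinearMap.toSpanSingleton ℝ (stdOrthonormalBasis ℝ H i)).comp_memLp'
        ((hn.memLp_drivingNoise hK t _).ae_eq (hNe t ht (stdOrthonormalBasis ℝ H i)).symm)
    simpa only [(stdOrthonormalBasis ℝ H).sum_repr'] using h
  refine ⟨hN, hm, fun t ht => ?_, fun s t hs hst ht => ?_, ?_⟩
  · refine clm_ext_inner fun a b => ?_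
    rw [inner_cross hX₀ (hm t ht), zero_apply, inner_zero_right,
      ← hn.integral_init_mul_drivingNoise (B := B) (t₀ := t₀) hX₀ hK t a b]
    refine integral_congr_ae ?_
    filter_upwards [hNe t ht b] with ω hω
    rw [← hω, real_inner_comm b]
  · refine clm_ext_inner fun a b => ?_
    have hs' : s ∈ Icc t₀ τ := ⟨hs, hst.trans ht⟩
    have ht' : t ∈ Icc t₀ τ := ⟨hs.trans hst, ht⟩
    rw [inner_cross (hm s hs') (hm t ht'), ← hn.integral_drivingNoise_mul hQ hR hK hs hst a b]
    refine integral_congr_ae ?_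
    filter_upwards [hNe s hs' a, hNe t ht' b] with ω h1 h2
    rw [← h1, ← h2, real_inner_comm b]
  · obtain ⟨c, hc₀, hc⟩ := exists_bound_noiseIntensity (B := B) hK hQ hR t₀ τ
    refine ⟨c * (τ - t₀), fun t ht => ?_⟩
    refine (intervalIntegral.norm_integral_le_of_norm_le_const (C := c) fun s hs => ?_).trans ?_
    · rw [uIoc_of_le ht.1] at hs
      exact hc s ⟨hs.1.le, hs.2.trans ht.2⟩
    · rw [abs_of_nonneg (sub_nonneg.2 ht.1)]
      exact mul_le_mul_of_nonneg_left (by linarith [ht.2]) hc₀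

/-- Reduces arbitrary directions `ζ` to finitely many, so that a vector-valued noise can be
assembled from its coordinates. -/
theorem drivingNoise_ae_eq_sum (hQ : MeasLocBdd Q) (hR : MeasLocBdd R) (hK : MeasLocBdd K)
    (t : ℝ) (ζ : H) : drivingNoise B K v w t₀ t ζ =ᵐ[P] fun ω =>
      ∑ i, ⟪stdOrthonormalBasis ℝ H i, ζ⟫_ℝ *
        drivingNoise B K v w t₀ t (stdOrthonormalBasis ℝ H i) ω := by
  have key : ∀ {Γ : ℝ → E →L[ℝ] H}, ∀ r, gainTest Γ t₀ t ζ r =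
      ∑ i, ⟪stdOrthonormalBasis ℝ H i, ζ⟫_ℝ • gainTest Γ t₀ t (stdOrthonormalBasis ℝ H i) r := by
    intro Γ r
    by_cases hr : r ∈ Ioc t₀ t
    · simp only [gainTest, indicator_of_mem hr]
      conv_lhs => rw [← (stdOrthonormalBasis ℝ H).sum_repr' ζ]
      simp only [map_sum, map_smul]
    · simp only [gainTest, indicator_of_notMem hr, smul_zero, Finset.sum_const_zero]
  filter_upwards [hn.white_v.ae_eq_sum hR Finset.univ _ (isTestFun_gainTest hK t₀ t ζ)
      (fun i => isTestFun_gainTest hK t₀ t (stdOrthonormalBasis ℝ H i)) key,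
    hn.white_w.ae_eq_sum hQ Finset.univ _ (isTestFun_gainTest (.const B) t₀ t ζ)
      (fun i => isTestFun_gainTest (.const B) t₀ t (stdOrthonormalBasis ℝ H i)) key] with ω h1 h2
  simp only [drivingNoise, h1, h2, mul_sub, Finset.sum_sub_distrib]

/-- White noise provides a separate random variable for each `t` and `ζ`, with no regularity in `t`.
In a unit direction `e` the increment over `[s, t]` has mean square `⟪e, (∫ q) e⟫ ≤ c (t - s)`,
where `q` is the noise intensity, so each coordinate has a measurable modification. -/
theorem exists_measurable_drivingNoise (hQ : MeasLocBdd Q) (hR : MeasLocBdd R)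
    (hK : MeasLocBdd K) (B : E →L[ℝ] H) (t₀ τ : ℝ) : ∃ N : ℝ → Ω → H,
    Measurable (fun p : ℝ × Ω => N p.1 p.2) ∧
    ∀ t ∈ Icc t₀ τ, ∀ ζ, (fun ω => ⟪ζ, N t ω⟫_ℝ) =ᵐ[P] drivingNoise B K v w t₀ t ζ := by
  obtain ⟨c, hc₀, hc⟩ := exists_bound_noiseIntensity (B := B) hK hQ hR t₀ τ
  have hmod : ∀ i, ∃ Z : ℝ → Ω → ℝ, Measurable (fun p : ℝ × Ω => Z p.1 p.2) ∧
      ∀ t ∈ Icc t₀ τ, Z t =ᵐ[P] drivingNoise B K v w t₀ t (stdOrthonormalBasis ℝ H i) := by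
    intro i
    set e := stdOrthonormalBasis ℝ H i with he
    have hne : ‖e‖ = 1 := (stdOrthonormalBasis ℝ H).norm_eq_one i
    refine exists_measurable_modification (C := c) (hn.measurable_drivingNoise hK · e)
      (fun s t hs hst ht => ?_) hc₀
    have ms := hn.memLp_drivingNoise (B := B) (t₀ := t₀) hK s e
    have mt := hn.memLp_drivingNoise (B := B) (t₀ := t₀) hK t e
    have hi := (mt.sub ms).integrable_sq
    have hIt := intervalIntegrable_of_Icc (integrableOn_noiseIntensity (B := B) hK hQ hR t₀ τ)
      ⟨hs.trans hst, ht⟩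
    have hIs := intervalIntegrable_of_Icc (integrableOn_noiseIntensity (B := B) hK hQ hR t₀ τ)
      ⟨hs, hst.trans ht⟩
    simp only [Pi.sub_apply] at hi
    rw [← ofReal_integral_eq_lintegral_ofReal hi (ae_of_all _ fun ω => sq_nonneg _)]
    refine ENNReal.ofReal_le_ofReal ?_
    have e1 : ∀ ω, (drivingNoise B K v w t₀ t e ω - drivingNoise B K v w t₀ s e ω) ^ 2 =
        drivingNoise B K v w t₀ t e ω * drivingNoise B K v w t₀ t e ω +
          drivingNoise B K v w t₀ s e ω * drivingNoise B K v w t₀ s e ω -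
          2 * (drivingNoise B K v w t₀ s e ω * drivingNoise B K v w t₀ t e ω) := fun ω => by ring
    simp_rw [e1]
    have j1 : Integrable (fun ω => drivingNoise B K v w t₀ t e ω *
        drivingNoise B K v w t₀ t e ω) P := mt.integrable_mul mt
    have j2 : Integrable (fun ω => drivingNoise B K v w t₀ s e ω *
        drivingNoise B K v w t₀ s e ω) P := ms.integrable_mul ms
    have j3 : Integrable (fun ω => drivingNoise B K v w t₀ s e ω *
        drivingNoise B K v w t₀ t e ω) P := ms.integrable_mul mt
    rw [integral_sub (f := fun ω => drivingNoise B K v w t₀ t e ω * drivingNoise B K v w t₀ t e ω +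
          drivingNoise B K v w t₀ s e ω * drivingNoise B K v w t₀ s e ω) (j1.add j2)
        (j3.const_mul 2), integral_add j1 j2, integral_const_mul,
      hn.integral_drivingNoise_mul hQ hR hK (hs.trans hst) le_rfl,
      hn.integral_drivingNoise_mul hQ hR hK hs le_rfl,
      hn.integral_drivingNoise_mul hQ hR hK hs hst]
    -- By orthogonality of increments the mixed moment equals the second moment at the earlier time
    -- `s`.
    have e2 : ∀ a b : ℝ, a + b - 2 * b = a - b := fun a b => by ring
    rw [e2, ← inner_sub_right, ← sub_apply, intervalIntegral.integral_interval_sub_left hIt hIs]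
    refine (real_inner_le_norm _ _).trans ?_
    rw [hne, one_mul]
    refine (ContinuousLinearMap.le_opNorm _ _).trans ?_
    rw [hne, mul_one]
    refine (intervalIntegral.norm_integral_le_of_norm_le_const (C := c) fun r hr => ?_).trans ?_
    · rw [uIoc_of_le hst] at hr
      exact hc r ⟨hs.trans hr.1.le, hr.2.trans ht⟩
    · rw [abs_of_nonneg (sub_nonneg.2 hst)]
  choose Z hZm hZ using hmod
  refine ⟨fun t ω => ∑ i, Z i t ω • stdOrthonormalBasis ℝ H i,
    Finset.measurable_fun_sum _ fun i _ => (hZm i).smul_const _, fun t ht ζ => ?_⟩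
  filter_upwards [hn.drivingNoise_ae_eq_sum (B := B) (t₀ := t₀) hQ hR hK t ζ,
    ae_all_iff.2 fun i => hZ i t ht] with ω h1 h2
  rw [h1, inner_sum]
  refine Finset.sum_congr rfl fun i _ => ?_
  rw [real_inner_smul_right, h2 i, mul_comm, real_inner_comm]

end NoiseAssumption

end WhiteNoise

/-! ### The error equation driven by white noise -/

section ErrorEquation

variable {E H : Type*} [NormedAddCommGroup E] [InnerProductSpace ℝ E] [FiniteDimensional ℝ E]
  [MeasurableSpace E] [BorelSpace E] [NormedAddCommGroup H] [InnerProductSpace ℝ H]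
  [FiniteDimensional ℝ H] [MeasurableSpace H] [BorelSpace H]
  {Ω : Type*} [MeasurableSpace Ω] {P : Measure Ω} [IsProbabilityMeasure P]
  {Q R : ℝ → E →L[ℝ] E} {v w : (ℝ → E) → Ω → ℝ} {B : E →L[ℝ] H} {C : H →L[ℝ] E}
  {A : ℝ → H →L[ℝ] H} {K : ℝ → E →L[ℝ] H} {t₀ τ : ℝ} {X₀ : Ω → H} {Δ : ℝ → Ω → H}

/-- The equation `Δ̇ = (A - K C) Δ - B w + K v`, integrated over `[t₀, t]` and paired with
vectors. -/
def SatisfiesErrorEq (P : Measure Ω) (t₀ τ : ℝ) (A : ℝ → H →L[ℝ] H) (B : E →L[ℝ] H)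
    (C : H →L[ℝ] E) (K : ℝ → E →L[ℝ] H) (v w : (ℝ → E) → Ω → ℝ) (X₀ : Ω → H)
    (Δ : ℝ → Ω → H) : Prop :=
  ∀ t ∈ Icc t₀ τ, ∀ ζ : H, ∀ᵐ ω ∂P, ⟪ζ, Δ t ω⟫_ℝ = ⟪ζ, X₀ ω⟫_ℝ
    + (∫ s in t₀..t, ⟪ζ, gainDrift C A K s (Δ s ω)⟫_ℝ)
    - w (gainTest (fun _ => B) t₀ t ζ) ω + v (gainTest K t₀ t ζ) ω

theorem inner_integral_gainDrift (hA : Continuous A) (hK : MeasLocBdd K) {x : ℝ → H}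
    (hx : IntegrableOn x (Icc t₀ τ)) {t : ℝ} (ht : t ∈ Icc t₀ τ) (ζ : H) :
    ⟪ζ, ∫ s in t₀..t, gainDrift C A K s (x s)⟫_ℝ =
      ∫ s in t₀..t, ⟪ζ, gainDrift C A K s (x s)⟫_ℝ := by
  obtain ⟨c, -, hc⟩ := exists_bound_gainDrift (C := C) hA hK t₀ τ
  exact ((innerSL ℝ ζ).intervalIntegral_comp_comm (intervalIntegrable_of_Icc
    (integrableOn_clm_apply (measurable_gainDrift hA hK) hc hx) ht)).symm

variable (hn : NoiseAssumption P Q R v w X₀) (hQ : MeasLocBdd Q) (hR : MeasLocBdd R)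
  (hA : Continuous A) (hK : MeasLocBdd K) (hX₀ : MemLp X₀ 2 P)
include hn hQ hR hA hK hX₀

/-- Taking `N` to be the residual `Δ - X₀ - ∫ L Δ` makes the equation hold for all paths and times
at once, although the hypothesis has an exceptional null set for each `t` and `ζ`. The weak equation
then serves to identify `N` as the driving noise. -/
theorem SatisfiesErrorEq.exists_isLinearSystem
    (hΔ : Measurable fun p : ℝ × Ω => Δ p.1 p.2)
    (hΔi : ∀ᵐ ω ∂P, IntegrableOn (fun s => Δ s ω) (Icc t₀ τ))
    (hdyn : SatisfiesErrorEq P t₀ τ A B C K v w X₀ Δ) :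
    ∃ c N, IsLinearSystem P t₀ τ c (gainDrift C A K)
      (fun t => ∫ s in t₀..t, noiseIntensity B Q R K s) X₀ N Δ := by
  obtain ⟨c, hc₀, hc⟩ := exists_bound_gainDrift (C := C) hA hK t₀ τ
  have hL := measurable_gainDrift (C := C) hA hK
  have hN : Measurable fun p : ℝ × Ω =>
      Δ p.1 p.2 - X₀ p.2 - ∫ s in t₀..p.1, gainDrift C A K s (Δ s p.2) :=
    (hΔ.sub (hn.measurable_init.comp measurable_snd)).sub
      (measurable_primitive (F := fun s ω => gainDrift C A K s (Δ s ω))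
        (measurable_clm_apply_uncurry hL hΔ) t₀)
  refine ⟨c, fun t ω => Δ t ω - X₀ ω - ∫ s in t₀..t, gainDrift C A K s (Δ s ω),
    hn.isAdditiveNoise hX₀ hQ hR hK hN fun t ht ζ => ?_, hX₀, hL, hc, hc₀,
    hΔ, hΔi, ae_of_all _ fun ω t _ => by abel⟩
  filter_upwards [hdyn t ht ζ, hΔi] with ω h1 h2
  rw [inner_sub_right, inner_sub_right, h1, inner_integral_gainDrift hA hK h2 ht, drivingNoise]
  ring

theorem SatisfiesErrorEq.solvesLyapunov
    (hΔ : Measurable fun p : ℝ × Ω => Δ p.1 p.2)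
    (hΔi : ∀ᵐ ω ∂P, IntegrableOn (fun s => Δ s ω) (Icc t₀ τ))
    (hdyn : SatisfiesErrorEq P t₀ τ A B C K v w X₀ Δ) :
    (∀ t ∈ Icc t₀ τ, MemLp (Δ t) 2 P) ∧
      IntegrableOn (fun t => secondMoment P (Δ t)) (Icc t₀ τ) ∧
      SolvesLyapunov t₀ τ (gainDrift C A K) (noiseIntensity B Q R K) (secondMoment P X₀)
        (fun t => secondMoment P (Δ t)) := by
  obtain ⟨c, N, h⟩ := hdyn.exists_isLinearSystem hn hQ hR hA hK hX₀ hΔ hΔi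
  have hSi : IntegrableOn (fun t => cross P (Δ t) (Δ t)) (Icc t₀ τ) := h.integrableOn_cross_self
  refine ⟨h.memLp, by simpa only [secondMoment_eq_cross] using hSi, fun t ht => ?_⟩
  have h₁ := intervalIntegrable_of_Icc (integrableOn_clm_comp h.measurable_coeff h.bound hSi) ht
  have h₂ := intervalIntegrable_of_Icc
    (integrableOn_comp_adjoint h.measurable_coeff h.bound hSi) ht
  have hq := intervalIntegrable_of_Icc (integrableOn_noiseIntensity (B := B) hK hQ hR t₀ τ) ht
  simp only [secondMoment_eq_cross, lyapunovField]
  rw [h.cross_self_eq ht, add_assoc, intervalIntegral.integral_add (h₁.add h₂) hq]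

theorem exists_satisfiesErrorEq (hle : t₀ ≤ τ) (B : E →L[ℝ] H) (C : H →L[ℝ] E) :
    ∃ Δ : ℝ → Ω → H, Measurable (fun p : ℝ × Ω => Δ p.1 p.2) ∧
      (∀ᵐ ω ∂P, IntegrableOn (fun s => Δ s ω) (Icc t₀ τ)) ∧ Δ t₀ =ᵐ[P] X₀ ∧
      SatisfiesErrorEq P t₀ τ A B C K v w X₀ Δ := by
  obtain ⟨c, -, hc⟩ := exists_bound_gainDrift (C := C) hA hK t₀ τ
  obtain ⟨N, hNm, hN⟩ := hn.exists_measurable_drivingNoise hQ hR hK B t₀ τ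
  have hadd := hn.isAdditiveNoise hX₀ hQ hR hK hNm hN
  have hNi : ∀ᵐ ω ∂P, IntegrableOn (fun s => N s ω) (Icc t₀ τ) :=
    (hadd.memLp_timeProd.integrable one_le_two).prod_left_ae
  obtain ⟨Δ, hΔm, hΔi, hΔ⟩ := exists_measurable_solution (P := P) (N := fun t ω => X₀ ω + N t ω)
    (measurable_gainDrift hA hK) hc ((hn.measurable_init.comp measurable_snd).add hNm)
    (hNi.mono fun ω hω => (integrableOn_const (by simp)).add hω)
  refine ⟨Δ, hΔm, hΔi, ?_, fun t ht ζ => ?_⟩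
  · have ht₀ : t₀ ∈ Icc t₀ τ := ⟨le_rfl, hle⟩
    -- The modification `N` need not vanish identically at `t₀`; it does so almost surely because
    -- its second moment there is an integral over an empty interval.
    have h0 : ∫ ω, ‖N t₀ ω‖ ^ 2 ∂P = 0 := by
      refine le_antisymm ?_ (integral_nonneg fun _ => sq_nonneg _)
      refine (integral_norm_sq_le_opNorm (hadd.memLp t₀ ht₀)).trans ?_
      rw [hadd.cross_eq t₀ t₀ le_rfl le_rfl hle]
      simp
    filter_upwards [hΔ, (integral_eq_zero_iff_of_nonneg (fun ω => sq_nonneg ‖N t₀ ω‖)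
      (hadd.memLp t₀ ht₀).norm.integrable_sq).1 h0] with ω h1 h2
    have h3 : N t₀ ω = 0 := by simpa using h2
    rw [h1 t₀ ht₀, intervalIntegral.integral_same, h3, zero_add, add_zero]
  · filter_upwards [hΔ, hΔi, hN t ht ζ] with ω h1 h2 h3
    rw [h1 t ht, inner_add_right, inner_add_right, inner_integral_gainDrift hA hK h2 ht, h3,
      drivingNoise]
    ring

end ErrorEquation

/-! ### Error processes and the equivalence of the control problems -/

section ErrorProcess

variable {E : Type*} [NormedAddCommGroup E] [InnerProductSpace ℝ E] [FiniteDimensional ℝ E]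
  [MeasurableSpace E] [BorelSpace E] {Ω : Type*} [MeasurableSpace Ω] {P : Measure Ω}
  [IsProbabilityMeasure P] {Q R : ℝ → E →L[ℝ] E} {v w : (ℝ → E) → Ω → ℝ}
  {A : ℝ → Sq E →L[ℝ] Sq E} {K : ℝ → E →L[ℝ] Sq E} {t₀ τ : ℝ} {Δ₀ : Ω → Sq E}
  {Δ : ℝ → Ω → Sq E} {S₀ : Sq E →L[ℝ] Sq E} {T T' : ℝ → Sq E →L[ℝ] Sq E}

theorem IsErrorProcess.satisfiesErrorEq (h : IsErrorProcess P t₀ τ A K v w Δ₀ Δ) :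
    SatisfiesErrorEq P t₀ τ A opB opC K v w Δ₀ Δ := h.dynamics

theorem covField_eq_lyapunovField :
    covField A Q R K = lyapunovField (gainDrift opC A K) (noiseIntensity opB Q R K) := by
  funext t S
  exact covField_eq t S

theorem SolvesCovDyn.solvesLyapunov (h : SolvesCovDyn t₀ τ A Q R K S₀ T) :
    SolvesLyapunov t₀ τ (gainDrift opC A K) (noiseIntensity opB Q R K) S₀ T := by
  have := h.integral_eq
  rwa [covField_eq_lyapunovField] at this

theorem SolvesCovDyn.eqOn (hA : Continuous A) (hK : MeasLocBdd K) (hQ : MeasLocBdd Q)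
    (hR : MeasLocBdd R) (hT : SolvesCovDyn t₀ τ A Q R K S₀ T)
    (hT' : SolvesCovDyn t₀ τ A Q R K S₀ T') : ∀ t ∈ Icc t₀ τ, T t = T' t := by
  obtain ⟨c, hc₀, hc⟩ := exists_bound_gainDrift (C := opC) hA hK t₀ τ
  exact hT.solvesLyapunov.eqOn hT'.solvesLyapunov (measurable_gainDrift hA hK) hc₀ hc
    (integrableOn_noiseIntensity hK hQ hR t₀ τ)
    (ContinuousOn.integrableOn_Icc (E := Sq E →L[ℝ] Sq E) hT.continuousOn)
    (ContinuousOn.integrableOn_Icc (E := Sq E →L[ℝ] Sq E) hT'.continuousOn)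

variable (hn : NoiseAssumption P Q R v w Δ₀) (hQ : MeasLocBdd Q) (hR : MeasLocBdd R)
  (hA : Continuous A) (hK : MeasLocBdd K) (hΔ₀ : MemLp Δ₀ 2 P) (hle : t₀ ≤ τ)
include hn hQ hR hA hK hΔ₀ hle

/-- The error process is square-integrable, and its second moment solves the covariance equation. -/
theorem IsErrorProcess.memLp_and_solvesCovDyn (h : IsErrorProcess P t₀ τ A K v w Δ₀ Δ) :
    (∀ t ∈ Icc t₀ τ, MemLp (Δ t) 2 P) ∧
      SolvesCovDyn t₀ τ A Q R K (secondMoment P Δ₀) (fun t => secondMoment P (Δ t)) := by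
  obtain ⟨hm, hT, hs⟩ := h.satisfiesErrorEq.solvesLyapunov hn hQ hR hA hK hΔ₀ h.measurable
    h.integrable
  obtain ⟨c, -, hc⟩ := exists_bound_gainDrift (C := opC) hA hK t₀ τ
  have hL := measurable_gainDrift (C := opC) hA hK
  have hq := integrableOn_noiseIntensity (B := opB) hK hQ hR t₀ τ
  refine ⟨hm, hs.continuousOn hL hc hq hT, ?_, ?_, ?_, ?_⟩
  · have := hs t₀ ⟨le_rfl, hle⟩
    rwa [intervalIntegral.integral_same, add_zero] at this
  · rw [covField_eq_lyapunovField]; exact hs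
  · rw [covField_eq_lyapunovField]; exact hs.ae_hasDerivAt hL hc hq hT
  · intro t ht hKt hQt hRt
    rw [covField_eq_lyapunovField]
    exact hs.hasDerivWithinAt hL hc hq hT ht (continuousWithinAt_gainDrift hA hKt)
      (continuousWithinAt_noiseIntensity hKt hQt hRt)

theorem exists_isErrorProcess : ∃ Δ, IsErrorProcess P t₀ τ A K v w Δ₀ Δ := by
  obtain ⟨Δ, hm, hi, h0, hd⟩ := exists_satisfiesErrorEq hn hQ hR hA hK hΔ₀ hle opB opC
  exact ⟨Δ, hm, hi, h0, hd⟩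

omit hn hQ hR hA hK hΔ₀ hle in
theorem stochCost_eq_detCost (M : Sq E →L[ℝ] Sq E) (h : MemLp (Δ τ) 2 P) :
    stochCost P τ M Δ = detCost τ M fun t => secondMoment P (Δ t) :=
  integral_inner_apply_eq_opInner M h

omit hK hle in
/-- The stochastic and the deterministic optimal control problems are equivalent. -/
theorem control_problems_equivalent (hle : t₀ ≤ τ) (hS₀ : secondMoment P Δ₀ = S₀)
    (M : Sq E →L[ℝ] Sq E) (𝒦 : Set (ℝ → E →L[ℝ] Sq E)) (h𝒦 : ∀ K ∈ 𝒦, MeasLocBdd K) :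
    (∀ K ∈ 𝒦, ∃ Δ, (K, Δ) ∈ stochFeasible P t₀ τ A v w Δ₀ 𝒦) ∧
    (∀ K ∈ 𝒦, ∃ S, (K, S) ∈ detFeasible t₀ τ A Q R S₀ 𝒦) ∧
    (∀ K Δ S, (K, Δ) ∈ stochFeasible P t₀ τ A v w Δ₀ 𝒦 → (K, S) ∈ detFeasible t₀ τ A Q R S₀ 𝒦 →
      (∀ t ∈ Icc t₀ τ, S t = secondMoment P (Δ t)) ∧ stochCost P τ M Δ = detCost τ M S) ∧
    ((fun p => stochCost P τ M p.2) '' stochFeasible P t₀ τ A v w Δ₀ 𝒦 =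
      (fun p => detCost τ M p.2) '' detFeasible t₀ τ A Q R S₀ 𝒦) ∧
    (∀ K, (∃ Δ, (K, Δ) ∈ stochFeasible P t₀ τ A v w Δ₀ 𝒦 ∧
        IsMinOn (fun p => stochCost P τ M p.2) (stochFeasible P t₀ τ A v w Δ₀ 𝒦) (K, Δ)) ↔
      (∃ S, (K, S) ∈ detFeasible t₀ τ A Q R S₀ 𝒦 ∧
        IsMinOn (fun p => detCost τ M p.2) (detFeasible t₀ τ A Q R S₀ 𝒦) (K, S))) := by
  have hstoch : ∀ K ∈ 𝒦, ∃ Δ, (K, Δ) ∈ stochFeasible P t₀ τ A v w Δ₀ 𝒦 := fun K hK => by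
    obtain ⟨Δ, hΔ⟩ := exists_isErrorProcess hn hQ hR hA (h𝒦 K hK) hΔ₀ hle
    exact ⟨Δ, hK, hΔ⟩
  -- Solvability of the covariance equation is read off from the stochastic problem: the second
  -- moment of an error process is a solution.
  have hdet : ∀ K ∈ 𝒦, ∃ S, (K, S) ∈ detFeasible t₀ τ A Q R S₀ 𝒦 := fun K hK => by
    obtain ⟨Δ, -, hΔ⟩ := hstoch K hK
    refine ⟨fun t => secondMoment P (Δ t), hK, ?_⟩
    rw [← hS₀]
    exact (hΔ.memLp_and_solvesCovDyn hn hQ hR hA (h𝒦 K hK) hΔ₀ hle).2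
  have hagree : ∀ K Δ S, (K, Δ) ∈ stochFeasible P t₀ τ A v w Δ₀ 𝒦 →
      (K, S) ∈ detFeasible t₀ τ A Q R S₀ 𝒦 →
      (∀ t ∈ Icc t₀ τ, S t = secondMoment P (Δ t)) ∧ stochCost P τ M Δ = detCost τ M S := by
    intro K Δ S hΔ hS
    have hK := h𝒦 K hΔ.1
    obtain ⟨hm, hs⟩ := IsErrorProcess.memLp_and_solvesCovDyn hn hQ hR hA hK hΔ₀ hle hΔ.2
    rw [hS₀] at hs
    -- Uniqueness for the covariance equation identifies an arbitrary solution with the second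
    -- moment; the remaining claims then follow by exchanging feasible partners of the same gain.
    have he : ∀ t ∈ Icc t₀ τ, S t = secondMoment P (Δ t) :=
      SolvesCovDyn.eqOn hA hK hQ hR hS.2 hs
    have hτ : τ ∈ Icc t₀ τ := ⟨hle, le_rfl⟩
    refine ⟨he, (stochCost_eq_detCost M (hm τ hτ)).trans ?_⟩
    exact (congrArg (opInner M) (he τ hτ)).symm
  refine ⟨hstoch, hdet, hagree, ?_, fun K => ⟨?_, ?_⟩⟩
  · ext x
    constructor
    · rintro ⟨⟨K, Δ⟩, hΔ, rfl⟩
      obtain ⟨S, hS⟩ := hdet K hΔ.1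
      exact ⟨(K, S), hS, (hagree K Δ S hΔ hS).2.symm⟩
    · rintro ⟨⟨K, S⟩, hS, rfl⟩
      obtain ⟨Δ, hΔ⟩ := hstoch K hS.1
      exact ⟨(K, Δ), hΔ, (hagree K Δ S hΔ hS).2⟩
  · rintro ⟨Δ, hΔ, hmin⟩
    obtain ⟨S, hS⟩ := hdet K hΔ.1
    refine ⟨S, hS, isMinOn_iff.2 ?_⟩
    rintro ⟨K', S'⟩ hS'
    obtain ⟨Δ', hΔ'⟩ := hstoch K' hS'.1
    have := isMinOn_iff.1 hmin (K', Δ') hΔ'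
    simpa only [(hagree K Δ S hΔ hS).2, (hagree K' Δ' S' hΔ' hS').2] using this
  · rintro ⟨S, hS, hmin⟩
    obtain ⟨Δ, hΔ⟩ := hstoch K hS.1
    refine ⟨Δ, hΔ, isMinOn_iff.2 ?_⟩
    rintro ⟨K', Δ'⟩ hΔ'
    obtain ⟨S', hS'⟩ := hdet K' hΔ'.1
    have := isMinOn_iff.1 hmin (K', S') hS'
    simpa only [(hagree K Δ S hΔ hS).2, (hagree K' Δ' S' hΔ' hS').2] using this

end ErrorProcess

/-- In finite dimension, continuity of an operator-valued map may be tested on vectors. There `ad`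
is linear in `η`, and the partial derivative of `f` is jointly continuous because `f` is jointly
smooth. -/
theorem continuous_errorGenerator {n : ℕ} {𝔤 : LieSubalgebra ℝ (Matrix (Fin n) (Fin n) ℝ)}
    {ip : InnerProductSpace.Core ℝ (Matrix (Fin n) (Fin n) ℝ)}
    {f : ℝ → MatLie 𝔤 ip → MatLie 𝔤 ip}
    (hf : ContDiff ℝ (⊤ : ℕ∞) (fun p : ℝ × MatLie 𝔤 ip => f p.1 p.2))
    {η : ℝ → MatLie 𝔤 ip} (hη : Continuous η) : Continuous (errorGenerator f η) := by
  have had : ∀ y, Continuous fun t => MatLie.ad (η t) y := fun y => by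
    let ℓ : MatLie 𝔤 ip →ₗ[ℝ] MatLie 𝔤 ip :=
      { toFun := fun x => MatLie.ad x y
        map_add' := fun a b => add_lie (L := 𝔤) (M := 𝔤) a b y
        map_smul' := fun r a => smul_lie (L := 𝔤) (M := 𝔤) r a y }
    exact ℓ.continuous_of_finiteDimensional.comp hη
  have hder : ∀ y, Continuous fun t => fderiv ℝ (f t) (η t) y := fun y => by
    have h : Continuous fun p : ℝ × MatLie 𝔤 ip => fderiv ℝ (f p.1) p.2 := by
      refine (ContDiff.fderiv (n := 0) (m := (⊤ : ℕ∞)) (f := fun (p : ℝ × MatLie 𝔤 ip) => f p.1)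
        (g := fun p => p.2) ?_ contDiff_snd (by norm_num)).continuous
      exact hf.comp ((contDiff_fst.comp contDiff_fst).prodMk contDiff_snd)
    exact (h.comp (continuous_id.prodMk hη)).clm_apply continuous_const
  refine continuous_clm_apply.2 fun x => ?_
  exact (WithLp.prodContinuousLinearEquiv 2 ℝ (MatLie 𝔤 ip) (MatLie 𝔤 ip)).symm.continuous.comp
    (((had x.fst).neg.add continuous_const).prodMk (hder x.snd))

theorem theorem1 {n : ℕ} (𝔤 : LieSubalgebra ℝ (Matrix (Fin n) (Fin n) ℝ))
    (ip : InnerProductSpace.Core ℝ (Matrix (Fin n) (Fin n) ℝ))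
    -- the dynamics and the estimate along which the error is linearized
    (f : ℝ → MatLie 𝔤 ip → MatLie 𝔤 ip)
    (hf : ContDiff ℝ (⊤ : ℕ∞) (fun p : ℝ × MatLie 𝔤 ip => f p.1 p.2))
    (η : ℝ → MatLie 𝔤 ip) (hη : Continuous η)
    -- the noise
    {Ω : Type*} [MeasurableSpace Ω] (P : Measure Ω) [IsProbabilityMeasure P]
    (Q R : ℝ → MatLie 𝔤 ip →L[ℝ] MatLie 𝔤 ip) (hQ : MeasLocBdd Q) (hR : MeasLocBdd R)
    (v w : (ℝ → MatLie 𝔤 ip) → Ω → ℝ)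
    -- the initial state, the horizon, the weight
    (Δ₀ : Ω → Sq (MatLie 𝔤 ip)) (hnoise : NoiseAssumption P Q R v w Δ₀)
    (t₀ τ : ℝ) (hτ : t₀ < τ)
    (M : Sq (MatLie 𝔤 ip) →L[ℝ] Sq (MatLie 𝔤 ip)) (hM : IsPosDefOp M) :
    -- the covariance of the error process, for an arbitrary square-integrable initial state
    (MemLp Δ₀ 2 P →
      ∀ K : ℝ → MatLie 𝔤 ip →L[ℝ] Sq (MatLie 𝔤 ip), MeasLocBdd K →
      ∀ Δ : ℝ → Ω → Sq (MatLie 𝔤 ip),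
        IsErrorProcess P t₀ τ (errorGenerator f η) K v w Δ₀ Δ →
        (∀ t ∈ Icc t₀ τ, MemLp (Δ t) 2 P) ∧
        SolvesCovDyn t₀ τ (errorGenerator f η) Q R K (secondMoment P Δ₀)
          (fun t => secondMoment P (Δ t)) ∧
        stochCost P τ M Δ = detCost τ M (fun t => secondMoment P (Δ t))) ∧
    -- equivalence of the two optimal control problems, for every class of admissible gains
    (∀ S₀ : Sq (MatLie 𝔤 ip) →L[ℝ] Sq (MatLie 𝔤 ip), IsPosDefOp S₀ →
      IsCenteredGaussian P Δ₀ S₀ →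
      ∀ 𝒦 : Set (ℝ → MatLie 𝔤 ip →L[ℝ] Sq (MatLie 𝔤 ip)), (∀ K ∈ 𝒦, MeasLocBdd K) →
        -- every admissible gain is feasible in both problems
        (∀ K ∈ 𝒦, ∃ Δ, (K, Δ) ∈ stochFeasible P t₀ τ (errorGenerator f η) v w Δ₀ 𝒦) ∧
        (∀ K ∈ 𝒦, ∃ S, (K, S) ∈ detFeasible t₀ τ (errorGenerator f η) Q R S₀ 𝒦) ∧
        -- for the same gain, the deterministic state is the covariance, with the same cost
        (∀ K Δ S, (K, Δ) ∈ stochFeasible P t₀ τ (errorGenerator f η) v w Δ₀ 𝒦 →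
          (K, S) ∈ detFeasible t₀ τ (errorGenerator f η) Q R S₀ 𝒦 →
          (∀ t ∈ Icc t₀ τ, S t = secondMoment P (Δ t)) ∧
          stochCost P τ M Δ = detCost τ M S) ∧
        -- the attainable values, hence the optimal values, agree
        ((fun p => stochCost P τ M p.2) ''
            stochFeasible P t₀ τ (errorGenerator f η) v w Δ₀ 𝒦 =
          (fun p => detCost τ M p.2) ''
            detFeasible t₀ τ (errorGenerator f η) Q R S₀ 𝒦) ∧
        -- the optimal gains agree
        (∀ K, (∃ Δ, (K, Δ) ∈ stochFeasible P t₀ τ (errorGenerator f η) v w Δ₀ 𝒦 ∧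
            IsMinOn (fun p => stochCost P τ M p.2)
              (stochFeasible P t₀ τ (errorGenerator f η) v w Δ₀ 𝒦) (K, Δ)) ↔
          (∃ S, (K, S) ∈ detFeasible t₀ τ (errorGenerator f η) Q R S₀ 𝒦 ∧
            IsMinOn (fun p => detCost τ M p.2)
              (detFeasible t₀ τ (errorGenerator f η) Q R S₀ 𝒦) (K, S)))) := by
  have hA := continuous_errorGenerator hf hη
  refine ⟨fun hΔ₀ K hK Δ hΔ => ?_, fun S₀ _ hG 𝒦 h𝒦 => ?_⟩
  · obtain ⟨hm, hs⟩ := hΔ.memLp_and_solvesCovDyn hnoise hQ hR hA hK hΔ₀ hτ.le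
    exact ⟨hm, hs, stochCost_eq_detCost M (hm τ ⟨hτ.le, le_rfl⟩)⟩
  · exact control_problems_equivalent hnoise hQ hR hA hG.gaussian.memLp_two hτ.le hG.covariance
      M 𝒦 h𝒦
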